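/- Let $J$ be a commutative ring, let $G$ be a group with a normal subgroup $B$, and put $H=G/B$. Suppose that there is an exact sequence of right $JG$-modules and $JG$-maps $$\cdots\to P_n\to P_{n-1}\to\cdots\to P_1\to P_0\to J\to 0,$$ where $J$ is the trivial module and each $P_j$ is projective as a $JB$-module, such that the induced maps $P_j\otimes_{JB}J\to P_{j-1}\otimes_{JB}J$ are zero for all $j\ge 1$. Regard $H_j(B,J)$ as a right $JH$-module through the action of $G$ induced by conjugation on $B$. Then, for every $p\ge 0$, there are isomorphisms of $J$-modules as follows. (i) For every left $JG$-module $M$ on which $B$ acts trivially, naturally in $M$, $$H_p(G,M)\cong\bigoplus_{i+j=p}\operatorname{Tor}_i^{JH}(H_j(B,J),M).$$ (ii) For every right $JG$-module $N$ on which $B$ acts trivially, naturally in $N$, $$H^p(G,N)\cong\bigoplus_{i+j=p}\operatorname{Ext}^i_{JH}(H_j(B,J),N).$$ -/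

import Mathlib

open CategoryTheory Limits

universe u

noncomputable section

/-!
Throughout, a `JG`-module is an object of `Rep J G`. As usual for group rings, a right `JG`-module
is identified with a left one through `g • x = x g⁻¹`. Under this identification, for a right
`JG`-module `X` and a left `JG`-module `M`, the tensor product `X ⊗_{JG} M` is the module of
coinvariants `(X ⊗_J M)_G`, whose left derived functors in `M` are `Rep.Tor J G`; and `X ⊗_{JG} J`
is the module of coinvariants `X_G`.
-/

namespace NormalHomology

variable {J G : Type u} [CommRing J] [Group G]

/-! ### Inner automorphisms act trivially on group homology -/

/-- The endomorphism of the chain complex of `A` given by the pair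
`(x ↦ g x g⁻¹ on G, a ↦ g a on A)`. -/
def innerChains (A : Rep.{u} J G) (g : G) :
    groupHomology.inhomogeneousChains A ⟶ groupHomology.inhomogeneousChains A :=
  groupHomology.chainsMap (MulAut.conj g).toMonoidHom
    (Rep.ofHom ⟨A.ρ g, fun x => by ext; simp [← Module.End.mul_apply, ← map_mul]⟩ :
      A ⟶ Rep.res (MulAut.conj g).toMonoidHom A)

/-- The endomorphism of `H_n(G, A)` given by `(x ↦ g x g⁻¹ on G, a ↦ g a on A)`. -/
def innerMap (A : Rep.{u} J G) (g : G) (n : ℕ) : groupHomology A n ⟶ groupHomology A n :=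
  HomologicalComplex.homologyMap (innerChains A g) n

lemma innerChains_naturality {A C : Rep.{u} J G} (f : A ⟶ C) (g : G) :
    innerChains A g ≫ groupHomology.chainsMap (MonoidHom.id G) f =
      groupHomology.chainsMap (MonoidHom.id G) f ≫ innerChains C g := by
  rw [innerChains, innerChains, ← groupHomology.chainsMap_comp, ← groupHomology.chainsMap_comp]
  refine groupHomology.chainsMap_congr rfl ?_
  ext x
  exact Rep.hom_comm_apply f g x

lemma innerMap_zero (A : Rep.{u} J G) (g : G) : innerMap A g 0 = 𝟙 (groupHomology A 0) := by
  have h : groupHomology.H0π A ≫ innerMap A g 0 =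
      ModuleCat.ofHom (A.ρ g) ≫ groupHomology.H0π A :=
    groupHomology.H0π_comp_map (MulAut.conj g).toMonoidHom
      (Rep.ofHom ⟨A.ρ g, fun x => by ext; simp [← Module.End.mul_apply, ← map_mul]⟩ :
        A ⟶ Rep.res (MulAut.conj g).toMonoidHom A)
  refine (cancel_epi (groupHomology.H0π A)).1 (h.trans ?_)
  refine (cancel_mono (groupHomology.H0Iso A).hom).1 ?_
  rw [Category.comp_id, Category.assoc, groupHomology.H0π_comp_H0Iso_hom]
  ext x
  exact Representation.Coinvariants.mk_self_apply A.ρ g x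

lemma innerMap_eq_id (n : ℕ) : ∀ (A : Rep.{u} J G) (g : G),
    innerMap A g n = 𝟙 (groupHomology A n) := by
  induction n with
  | zero => exact innerMap_zero
  | succ n ih =>
    intro A g
    classical
    let I := Rep.ind (⊥ : Subgroup G).subtype (Rep.res (⊥ : Subgroup G).subtype A)
    let p : I ⟶ A := (Rep.indResAdjunction.{u} J (⊥ : Subgroup G).subtype).counit.app A
    have hp : Epi p := Adjunction.counit_epi_of_R_faithful _ A
    have hI : IsZero (groupHomology I (n + 1)) :=
      (isZero_groupHomology_succ_of_subsingleton
        (Rep.res (⊥ : Subgroup G).subtype A) n).of_iso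
        (groupHomology.indIso ⊥ (Rep.res (⊥ : Subgroup G).subtype A) (n + 1))
    let X : ShortComplex (Rep.{u} J G) := ShortComplex.mk (kernel.ι p) p (by simp)
    have hX : X.ShortExact :=
      { exact := ShortComplex.exact_kernel p
        mono_f := inferInstanceAs (Mono (kernel.ι p))
        epi_g := hp }
    have := groupHomology.mono_δ_of_isZero hX n hI
    let S := X.map (groupHomology.chainsFunctor J G)
    let φ : S ⟶ S :=
      { τ₁ := innerChains _ g
        τ₂ := innerChains _ g
        τ₃ := innerChains _ g
        comm₁₂ := innerChains_naturality _ g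
        comm₂₃ := innerChains_naturality _ g }
    have hδ : groupHomology.δ hX (n + 1) n rfl ≫ innerMap _ g n =
        innerMap A g (n + 1) ≫ groupHomology.δ hX (n + 1) n rfl :=
      HomologicalComplex.HomologySequence.δ_naturality φ
        (groupHomology.map_chainsFunctor_shortExact hX)
        (groupHomology.map_chainsFunctor_shortExact hX) (n + 1) n rfl
    refine (cancel_mono (groupHomology.δ hX (n + 1) n rfl)).1 ?_
    refine hδ.symm.trans ?_
    rw [ih, Category.comp_id]
    exact (Category.id_comp _).symm

/-! ### The action of `G/B` on the homology of a normal subgroup `B` -/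

variable (B : Subgroup G) [B.Normal]

/-- The endomorphism of `H_n(B, A)` induced by the pair `(b ↦ g b g⁻¹ on B, a ↦ g a on A)`. -/
def conjMap (A : Rep.{u} J G) (n : ℕ) (g : G) :
    groupHomology (Rep.res B.subtype A) n ⟶ groupHomology (Rep.res B.subtype A) n :=
  groupHomology.map (MulAut.conjNormal g : MulAut B).toMonoidHom
    (Rep.ofHom ⟨A.ρ g, fun b => by
      ext; simp [← Module.End.mul_apply, ← map_mul, MulAut.conjNormal_apply]⟩ :
      Rep.res B.subtype A ⟶ Rep.res (MulAut.conjNormal g : MulAut B).toMonoidHom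
        (Rep.res B.subtype A)) n

lemma conjMap_one (A : Rep.{u} J G) (n : ℕ) : conjMap B A n 1 = 𝟙 _ := by
  refine Eq.trans ?_ (groupHomology.map_id n)
  refine groupHomology.map_congr ?_ ?_ n
  · ext; simp
  · ext; simp

lemma conjMap_mul (A : Rep.{u} J G) (n : ℕ) (g h : G) :
    conjMap B A n (g * h) = conjMap B A n h ≫ conjMap B A n g := by
  refine Eq.trans ?_ (groupHomology.map_comp _ _ _ _ n)
  refine groupHomology.map_congr ?_ ?_ n
  · ext; simp
  · ext; simp

lemma conjMap_coe (A : Rep.{u} J G) (n : ℕ) (b : B) : conjMap B A n b = 𝟙 _ := by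
  refine Eq.trans ?_ (innerMap_eq_id n (Rep.res B.subtype A) b)
  refine groupHomology.map_congr ?_ ?_ n
  · ext; simp
  · ext; simp

/-- The conjugation action of `G` on `H_n(B, A)`. -/
def conjRepresentation (A : Rep.{u} J G) (n : ℕ) :
    Representation J G (groupHomology (Rep.res B.subtype A) n) where
  toFun g := (conjMap B A n g).hom
  map_one' := by rw [conjMap_one]; rfl
  map_mul' g h := by rw [conjMap_mul]; rfl

instance (A : Rep.{u} J G) (n : ℕ) :
    Representation.IsTrivial ((conjRepresentation B A n).comp B.subtype) where
  out b := congrArg ModuleCat.Hom.hom (conjMap_coe B A n b)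

/-- The homology `H_n(B, A)` of a normal subgroup `B` of `G` with coefficients in a `JG`-module
`A`, as a module over `J[G/B]`: the coset `gB` acts by the map induced by `b ↦ g b g⁻¹` and
`a ↦ g a`. -/
def homologyRep (A : Rep.{u} J G) (n : ℕ) : Rep.{u} J (G ⧸ B) :=
  Rep.ofQuotient (Rep.of (conjRepresentation B A n)) B

/-- `M ↦ ⨁_{i+j=p} Tor_i^{J[G/B]}(H_j(B, J), M)`, where `J` is the trivial module. -/
def torSum (p : ℕ) : Rep.{u} J (G ⧸ B) ⥤ ModuleCat.{u} J where
  obj M := ⨁ fun ij : Finset.HasAntidiagonal.antidiagonal p =>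
    ((Rep.Tor J (G ⧸ B) ij.1.1).obj (homologyRep B (Rep.trivial J G J) ij.1.2)).obj M
  map f := biproduct.map fun ij : Finset.HasAntidiagonal.antidiagonal p =>
    ((Rep.Tor J (G ⧸ B) ij.1.1).obj (homologyRep B (Rep.trivial J G J) ij.1.2)).map f

/-- `N ↦ ⨁_{i+j=p} Ext^i_{J[G/B]}(H_j(B, J), N)`, where `J` is the trivial module. -/
def extSum (p : ℕ) : Rep.{u} J (G ⧸ B) ⥤ ModuleCat.{u} J where
  obj N := ⨁ fun ij : Finset.HasAntidiagonal.antidiagonal p =>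
    ((Ext J (Rep.{u} J (G ⧸ B)) ij.1.1).obj
      (Opposite.op (homologyRep B (Rep.trivial J G J) ij.1.2))).obj N
  map f := biproduct.map fun ij : Finset.HasAntidiagonal.antidiagonal p =>
    ((Ext J (Rep.{u} J (G ⧸ B)) ij.1.1).obj
      (Opposite.op (homologyRep B (Rep.trivial J G J) ij.1.2))).map f

/-! ### `JG`-modules on which `B` acts trivially -/

/-- The property of a `JG`-module that `B` acts trivially on it. -/
def trivialOn : ObjectProperty (Rep.{u} J G) :=
  fun A => Representation.IsTrivial (A.ρ.comp B.subtype)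

instance (A : (trivialOn (J := J) B).FullSubcategory) :
    Representation.IsTrivial (A.obj.ρ.comp B.subtype) := A.property

/-- A `JG`-module on which `B` acts trivially, regarded as a `J[G/B]`-module. -/
def toQuotient : (trivialOn (J := J) B).FullSubcategory ⥤ Rep.{u} J (G ⧸ B) where
  obj A := Rep.ofQuotient A.obj B
  map f := Rep.ofHom ⟨f.hom.hom.toLinearMap, fun x => by
    induction x using QuotientGroup.induction_on with
    | H g => exact f.hom.hom.2 g⟩

end NormalHomology

end

/-! Write `H = G/B`, and `X_B` for the `B`-coinvariants of a `JG`-module `X`, which form a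
`JH`-module. Let `L → J` be the bar resolution. If `B` acts trivially on `M` and `N`, then `M ⊗_{JG}
L` is `L_B ⊗_{JH} M` and `Hom_{JG}(L, N)` is `Hom_{JH}(L_B, N)`. So both sides are governed by
`L_B`, a complex of projective `JH`-modules.

The hypothesis makes `L_B` formal. Lift the identity of `J` to a `JG`-map `L → P`. Over `JB` both
complexes are projective resolutions of `J`, so the lift is a `JB`-homotopy equivalence and `L_B →
P_B` is a quasi-isomorphism of `JH`-complexes (`quasiIso_quotientToCoinvariants`). Since `P_B` has
zero differential, its terms are its homology, namely `H_j(B, J)`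
(`coinvariantsComplex_iso_homologyRep`).

It remains to see that if a complex `F` of projectives is quasi-isomorphic to a complex `Q` with
zero differential, then `H_p(Ψ F)` is the sum of the `L_i Ψ (Q_j)` with `i + j = p`, for `Ψ` right
exact (`DimensionShift.homology_iso_diagonalSum`). The map `F_1 → Q_1` splits the homology off `F_1
/ im F_2`, which becomes `Q_1 ⊕ Y` with `Y = ker(F_0 → Q_0)` a first syzygy of `Q_0`. The truncation
of `F` to degrees at least 1 is thus a complex of the same kind with `Q_1 ⊕ Y` in degree 0, and
`L_{p+1} Ψ (Q_1 ⊕ Y)` is `L_{p+1} Ψ (Q_1) ⊕ L_{p+2} Ψ (Q_0)`; induct on `p`. Only dimension shifting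
enters, so `DimensionShift` asks for no functoriality of the `T n`. It also covers `H_n(B, -)`, with
the `JB`-projective modules as acyclic objects.

For naturality, `Ψ` takes values in functors on the category `E` of `JG`-modules trivial on `B`: an
isomorphism of objects there is a natural isomorphism. For cohomology the target is `Eᵒᵖ ⥤
(ModuleCat J)ᵒᵖ`, which turns `Hom(-, N)` into a covariant right exact functor. -/

noncomputable section

namespace NormalHomology

/-! ### Dimension shifting and the splitting of homology -/

section DimensionShifting

variable {C : Type*} [Category* C] [Abelian C] {A : Type*} [Category* A] [Abelian A]

/-! ### Homology in low degrees -/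

/-- The homology of `X₁ ⟶ X₂ ⟶ X₃` is the kernel of the map induced by `X₂ ⟶ X₃` on a cokernel
of `X₁ ⟶ X₂`. -/
lemma nonempty_homology_iso_kernel (S : ShortComplex A) {Z : A} (c : S.X₂ ⟶ Z) (hc : S.f ≫ c = 0)
    (hex : (ShortComplex.mk S.f c hc).Exact) (_ : Epi c) (b : Z ⟶ S.X₃) (hb : c ≫ b = S.g) :
    Nonempty (S.homology ≅ kernel b) := by
  have hcok : IsColimit (CokernelCofork.ofπ c hc) := hex.gIsCokernel
  have hdesc : hcok.desc (CokernelCofork.ofπ S.g S.zero) = b := by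
    refine (cancel_epi c).1 ?_
    rw [hb]
    exact hcok.fac _ WalkingParallelPair.one
  let h : S.RightHomologyData :=
    { Q := Z
      H := kernel b
      p := c
      ι := kernel.ι b
      wp := hc
      hp := hcok
      wι := by rw [hdesc, kernel.condition]
      hι := KernelFork.IsLimit.ofι _ (by rw [hdesc, kernel.condition])
        (fun g hg => kernel.lift b g (by rw [← hdesc]; exact hg))
        (fun g hg => by simp)
        (fun g hg m hm => by rw [← cancel_mono (kernel.ι b), hm, kernel.lift_ι]) }
  exact ⟨h.homologyIso⟩

lemma nonempty_homology_zero_iso (K : ChainComplex A ℕ) {Z : A} (c : K.X 0 ⟶ Z)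
    (hc : K.d 1 0 ≫ c = 0) (hex : (ShortComplex.mk (K.d 1 0) c hc).Exact) (_ : Epi c) :
    Nonempty (K.homology 0 ≅ Z) :=
  ⟨K.isoHomologyι₀ ≪≫ (K.opcyclesIsCokernel 1 0 (by simp)).coconePointUniqueUpToIso
    hex.gIsCokernel⟩

/-- A right exact functor preserves exactness of `X₁ ⟶ X₂ ⟶ X₃ ⟶ 0`. -/
lemma exact_map_and_epi (Ψ : C ⥤ A) [Ψ.Additive] [PreservesFiniteColimits Ψ]
    {S : ShortComplex C} (hS : S.Exact) [Epi S.g] : (S.map Ψ).Exact ∧ Epi (Ψ.map S.g) :=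
  ⟨hS.map_of_epi_of_preservesCokernel Ψ inferInstance inferInstance, inferInstance⟩

/-! ### Dimension shifting data -/

/-- A sequence of operations `T n` satisfying dimension shifting along short exact sequences
`0 ⟶ X₁ ⟶ X₂ ⟶ X₃ ⟶ 0` with `X₂` in `P`, such that `T 0` is `Ψ`. -/
structure DimensionShift (Ψ : C ⥤ A) (P : C → Prop) (T : ℕ → C → A) : Prop where
  enough (X : C) : ∃ (F : C) (p : F ⟶ X), P F ∧ Epi p
  biprod (X Y : C) : P X → P Y → P (X ⊞ Y)
  zero (X : C) : Nonempty (T 0 X ≅ Ψ.obj X)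
  one (S : ShortComplex C) : S.ShortExact → P S.X₂ → Nonempty (T 1 S.X₃ ≅ kernel (Ψ.map S.f))
  succ (S : ShortComplex C) (n : ℕ) : S.ShortExact → P S.X₂ →
    Nonempty (T (n + 2) S.X₃ ≅ T (n + 1) S.X₁)

/-- The short exact sequence `0 ⟶ ker p ⟶ F ⟶ X ⟶ 0` of an epimorphism `p`. -/
abbrev kernelSequence {F X : C} (p : F ⟶ X) : ShortComplex C :=
  ShortComplex.mk (kernel.ι p) p (kernel.condition p)

lemma kernelSequence_shortExact {F X : C} (p : F ⟶ X) [Epi p] :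
    (kernelSequence p).ShortExact where
  exact := ShortComplex.exact_kernel p
  mono_f := inferInstanceAs (Mono (kernel.ι p))
  epi_g := inferInstanceAs (Epi p)

/-- The direct sum of two short complexes. -/
abbrev biprodSequence (S S' : ShortComplex C) : ShortComplex C :=
  ShortComplex.mk (biprod.map S.f S'.f) (biprod.map S.g S'.g) (by ext <;> simp)

lemma biprodSequence_shortExact {S S' : ShortComplex C} (hS : S.ShortExact) (hS' : S'.ShortExact) :
    (biprodSequence S S').ShortExact := by
  have := hS.mono_f
  have := hS'.mono_f
  have := hS.epi_g
  have := hS'.epi_g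
  refine { exact := ?_, mono_f := ?_, epi_g := ?_ }
  · refine ShortComplex.exact_of_f_is_kernel _ (KernelFork.IsLimit.ofι' _ _ fun {W} k hk => ?_)
    have h1 : (k ≫ biprod.fst) ≫ S.g = 0 := by simpa using hk =≫ biprod.fst
    have h2 : (k ≫ biprod.snd) ≫ S'.g = 0 := by simpa using hk =≫ biprod.snd
    exact ⟨biprod.lift (hS.exact.lift _ h1) (hS'.exact.lift _ h2), by ext <;> simp⟩
  · exact inferInstanceAs (Mono (biprod.map S.f S'.f))
  · exact inferInstanceAs (Epi (biprod.map S.g S'.g))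

lemma nonempty_kernel_biprodMap_iso {X Y X' Y' : A} (f : X ⟶ Y) (g : X' ⟶ Y') :
    Nonempty (kernel (biprod.map f g) ≅ kernel f ⊞ kernel g) :=
  ⟨{ hom := biprod.lift
        (kernel.lift f (kernel.ι _ ≫ biprod.fst)
          (by rw [Category.assoc, ← biprod.map_fst f g, kernel.condition_assoc, zero_comp]))
        (kernel.lift g (kernel.ι _ ≫ biprod.snd)
          (by rw [Category.assoc, ← biprod.map_snd f g, kernel.condition_assoc, zero_comp]))
     inv := kernel.lift _ (biprod.map (kernel.ι f) (kernel.ι g)) (by ext <;> simp)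
     hom_inv_id := by
       rw [← cancel_mono (kernel.ι _)]
       ext <;> simp
     inv_hom_id := by
       apply biprod.hom_ext
       · rw [← cancel_mono (kernel.ι f)]; simp
       · rw [← cancel_mono (kernel.ι g)]; simp }⟩

lemma nonempty_kernel_biprodDesc_iso {X X' Y : A} (g : X' ⟶ Y) :
    Nonempty (kernel (biprod.desc (0 : X ⟶ Y) g) ≅ X ⊞ kernel g) :=
  ⟨{ hom := biprod.lift (kernel.ι _ ≫ biprod.fst)
        (kernel.lift g (kernel.ι _ ≫ biprod.snd) (by
          have : biprod.desc (0 : X ⟶ Y) g = biprod.snd ≫ g := by ext <;> simp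
          rw [Category.assoc, ← this, kernel.condition]))
     inv := kernel.lift _ (biprod.map (𝟙 X) (kernel.ι g)) (by ext <;> simp)
     hom_inv_id := by
       rw [← cancel_mono (kernel.ι _)]
       ext <;> simp
     inv_hom_id := by
       apply biprod.hom_ext
       · simp
       · rw [← cancel_mono (kernel.ι g)]; simp }⟩

lemma nonempty_kernel_iso_of_comm {X Y X' Y' : A} {f : X ⟶ Y} {g : X' ⟶ Y'} (a : X ≅ X')
    (b : Y ≅ Y') (h : f ≫ b.hom = a.hom ≫ g) : Nonempty (kernel f ≅ kernel g) :=
  ⟨kernel.mapIso f g a b h⟩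

lemma map_biprodMap_comp_mapBiprod_hom (Ψ : C ⥤ A) [Ψ.PreservesZeroMorphisms]
    [PreservesBinaryBiproducts Ψ]
    {X Y X' Y' : C} (f : X ⟶ Y) (g : X' ⟶ Y') :
    Ψ.map (biprod.map f g) ≫ (Ψ.mapBiprod Y Y').hom =
      (Ψ.mapBiprod X X').hom ≫ biprod.map (Ψ.map f) (Ψ.map g) := by
  apply biprod.hom_ext <;>
    simp only [Functor.mapBiprod_hom, Category.assoc, biprod.lift_fst, biprod.lift_snd,
      biprod.map_fst, biprod.map_snd, biprod.lift_fst_assoc, biprod.lift_snd_assoc,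
      ← Functor.map_comp]

namespace DimensionShift

variable {Ψ : C ⥤ A} {P : C → Prop} {T : ℕ → C → A} (hT : DimensionShift Ψ P T)
include hT

/-- `T n` does not act on morphisms. The same cover `F` with the same kernel serves `X` and `Y`, and
for `n > 0` dimension shifting computes `T n` from that data. -/
lemma iso {X Y : C} (e : X ≅ Y) (n : ℕ) : Nonempty (T n X ≅ T n Y) := by
  obtain ⟨F, p, hF, hp⟩ := hT.enough X
  have h₁ := kernelSequence_shortExact p
  let S : ShortComplex C := ShortComplex.mk (kernel.ι p) (p ≫ e.hom) (by simp)
  have h₂ : S.ShortExact := ShortComplex.shortExact_of_iso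
    (S₁ := kernelSequence p) (S₂ := S)
    (ShortComplex.isoMk (Iso.refl _) (Iso.refl _) e (by simp [S]) (by simp [S])) h₁
  match n with
  | 0 => exact ⟨(hT.zero X).some ≪≫ Ψ.mapIso e ≪≫ (hT.zero Y).some.symm⟩
  | 1 => exact ⟨(hT.one _ h₁ hF).some ≪≫ (hT.one S h₂ hF).some.symm⟩
  | n + 2 => exact ⟨(hT.succ _ n h₁ hF).some ≪≫ (hT.succ S n h₂ hF).some.symm⟩

variable [Ψ.Additive]

/-- A sum of covers is a cover whose kernel is the sum of the kernels, so additivity propagates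
upwards from that of `Ψ`. -/
lemma biprod_iso (n : ℕ) : ∀ X Y : C, Nonempty (T n (X ⊞ Y) ≅ T n X ⊞ T n Y) := by
  induction n with
  | zero =>
    intro X Y
    have := preservesBinaryBiproduct_of_preservesBiproduct Ψ X Y
    exact ⟨(hT.zero _).some ≪≫ Ψ.mapBiprod X Y ≪≫
      biprod.mapIso (hT.zero X).some.symm (hT.zero Y).some.symm⟩
  | succ n ih =>
    intro X Y
    obtain ⟨F, p, hF, hp⟩ := hT.enough X
    obtain ⟨F', p', hF', hp'⟩ := hT.enough Y
    have h := kernelSequence_shortExact p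
    have h' := kernelSequence_shortExact p'
    have hb := biprodSequence_shortExact h h'
    have hP := hT.biprod F F' hF hF'
    match n with
    | 0 =>
      have := preservesBinaryBiproducts_of_preservesBiproducts Ψ
      exact ⟨(hT.one _ hb hP).some ≪≫ (nonempty_kernel_iso_of_comm (Ψ.mapBiprod _ _)
        (Ψ.mapBiprod _ _) (map_biprodMap_comp_mapBiprod_hom Ψ _ _)).some ≪≫
        (nonempty_kernel_biprodMap_iso (Ψ.map (kernel.ι p)) (Ψ.map (kernel.ι p'))).some ≪≫
        biprod.mapIso (hT.one _ h hF).some.symm (hT.one _ h' hF').some.symm⟩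
    | n + 1 =>
      exact ⟨(hT.succ _ n hb hP).some ≪≫ (ih _ _).some ≪≫
        biprod.mapIso (hT.succ _ n h hF).some.symm (hT.succ _ n h' hF').some.symm⟩

end DimensionShift

/-! ### The main induction -/

/-- The direct sum of the `T i (Q j)` over `i + j = p`. -/
def diagonalSum (T : ℕ → C → A) : ℕ → (ℕ → C) → A
  | 0, Q => T 0 (Q 0)
  | p + 1, Q => T (p + 1) (Q 0) ⊞ diagonalSum T p fun n => Q (n + 1)

/-- If the homology of `X₁ ⟶ X₂ ⟶ X₃` is a direct summand of the cokernel of `X₁ ⟶ X₂`,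
then the latter splits as the sum of the homology and the image of `X₂ ⟶ X₃`. -/
lemma opcycles_iso_biprod (S : ShortComplex C) {Q : C} (φ : S.X₂ ⟶ Q) (hφ : S.f ≫ φ = 0)
    [IsIso (S.homologyι ≫ S.descOpcycles φ hφ)] {Z W : C} (i : Z ⟶ S.X₃) (_ : Mono i) (q : S.X₃ ⟶ W)
    (hiq : i ≫ q = 0) (hex : (ShortComplex.mk i q hiq).Exact) (hgq : S.g ≫ q = 0)
    (hex' : (ShortComplex.mk S.g q hgq).Exact) :
    ∃ e : S.opcycles ≅ Q ⊞ Z, S.fromOpcycles = e.hom ≫ biprod.desc 0 i := by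
  have hfq : S.fromOpcycles ≫ q = 0 := by simp [← cancel_epi S.pOpcycles, hgq]
  let r : S.opcycles ⟶ Z := hex.lift S.fromOpcycles hfq
  have hr : r ≫ i = S.fromOpcycles := hex.lift_f _ _
  -- By exactness `i` identifies `Z` with the kernel of `q`, onto which `S.g` maps epimorphically;
  -- `S.g` factors through `r`.
  have hrepi : Epi r := by
    have hi : S.g ≫ q = 0 := hgq
    have h1 : Epi (hex.lift S.g hgq) := by
      have h2 := (ShortComplex.exact_iff_epi_kernel_lift _).1 hex'
      have h4 : IsIso (kernel.lift q i hiq) := by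
        have := (ShortComplex.exact_iff_epi_kernel_lift _).1 hex
        dsimp at this
        have : Mono (kernel.lift q i hiq) := mono_of_mono_fac (kernel.lift_ι q i hiq)
        exact isIso_of_mono_of_epi _
      have h5 : hex.lift S.g hgq = kernel.lift q S.g hgq ≫ inv (kernel.lift q i hiq) := by
        rw [IsIso.eq_comp_inv, ← cancel_mono (kernel.ι q)]
        simp
        exact hex.lift_f _ _
      rw [h5]
      dsimp at h2
      infer_instance
    have h6 : S.pOpcycles ≫ r = hex.lift S.g hgq := by
      rw [← cancel_mono i, Category.assoc, hr]
      simp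
      exact (hex.lift_f _ _).symm
    exact epi_of_epi_fac h6
  have hzero : S.homologyι ≫ r = 0 := by
    rw [← cancel_mono i, Category.assoc, hr]; simp
  let S' : ShortComplex C := ShortComplex.mk S.homologyι r hzero
  have hS' : S'.Exact := by
    refine ShortComplex.exact_of_f_is_kernel _ (KernelFork.IsLimit.ofι' _ _ fun {W} k hk => ?_)
    have hk' : k ≫ S.fromOpcycles = 0 := by
      rw [← hr, ← Category.assoc]
      rw [show k ≫ r = 0 from hk, zero_comp]
    exact ⟨S.liftHomology k hk', by simp [S']⟩
  -- The retraction onto the homology is the map induced by `φ`, corrected by the inverse of the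
  -- assumed isomorphism with `Q`.
  let s : S'.Splitting := ShortComplex.Splitting.ofExactOfRetraction S' hS'
    (S.descOpcycles φ hφ ≫ inv (S.homologyι ≫ S.descOpcycles φ hφ))
    (by simp [S', ← Category.assoc]) hrepi
  obtain ⟨ρ, e, he⟩ : ∃ (ρ : S.opcycles ⟶ S.homology) (e : S.opcycles ≅ S.homology ⊞ Z),
      e.hom = biprod.lift ρ r := ⟨s.r, s.isoBinaryBiproduct, rfl⟩
  refine ⟨e ≪≫ biprod.mapIso (asIso (S.homologyι ≫ S.descOpcycles φ hφ)) (Iso.refl _), ?_⟩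
  simp [he, hr, biprod.lift_eq]

/-- Right exactness makes `Ψ.obj S.opcycles` the cokernel of `Ψ.map S.f`, so the homology is the
kernel of `Ψ.map S.fromOpcycles`. This map vanishes on the summand `Q` and is `Ψ.map i` on `Z`. -/
lemma homology_map_iso_biprod (Ψ : C ⥤ A) [Ψ.Additive] [PreservesFiniteColimits Ψ]
    (S : ShortComplex C) {Q Z : C} (i : Z ⟶ S.X₃) (e : S.opcycles ≅ Q ⊞ Z)
    (he : S.fromOpcycles = e.hom ≫ biprod.desc 0 i) :
    Nonempty ((S.map Ψ).homology ≅ Ψ.obj Q ⊞ kernel (Ψ.map i)) := by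
  have := preservesBinaryBiproducts_of_preservesBiproducts Ψ
  have hS : (ShortComplex.mk S.f S.pOpcycles (by simp)).Exact :=
    ShortComplex.exact_of_g_is_cokernel _ S.opcyclesIsCokernel
  have : Epi (ShortComplex.mk S.f S.pOpcycles (by simp)).g :=
    inferInstanceAs (Epi S.pOpcycles)
  obtain ⟨h₁, h₂⟩ := exact_map_and_epi Ψ hS
  obtain ⟨a⟩ := nonempty_homology_iso_kernel (S.map Ψ) (Ψ.map S.pOpcycles)
    _ h₁ h₂ (Ψ.map S.fromOpcycles)
    ((Ψ.map_comp _ _).symm.trans (congrArg Ψ.map S.p_fromOpcycles))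
  have h₃ : (Ψ.mapBiprod Q Z).hom ≫ biprod.desc (0 : Ψ.obj Q ⟶ Ψ.obj S.X₃) (Ψ.map i) =
      Ψ.map (biprod.desc 0 i) := by
    have h₄ : biprod.desc (0 : Q ⟶ S.X₃) i = biprod.snd ≫ i := by ext <;> simp
    have h₅ : biprod.desc (0 : Ψ.obj Q ⟶ Ψ.obj S.X₃) (Ψ.map i) = biprod.snd ≫ Ψ.map i := by
      ext <;> simp
    rw [h₄, h₅, Functor.mapBiprod_hom, biprod.lift_snd_assoc, Functor.map_comp]
  obtain ⟨a'⟩ := nonempty_kernel_iso_of_comm (f := Ψ.map S.fromOpcycles)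
    (g := biprod.desc (0 : Ψ.obj Q ⟶ Ψ.obj S.X₃) (Ψ.map i))
    (Ψ.mapIso e ≪≫ Ψ.mapBiprod _ _) (Iso.refl _) (by
      rw [Iso.refl_hom, Category.comp_id, Iso.trans_hom, Category.assoc, h₃, he,
        Functor.map_comp, Functor.mapIso_hom])
  exact ⟨a ≪≫ a' ≪≫ (nonempty_kernel_biprodDesc_iso _).some⟩

variable {Ψ : C ⥤ A} {P : C → Prop} {T : ℕ → C → A} (hT : DimensionShift Ψ P T)
  [Ψ.Additive] [PreservesFiniteColimits Ψ]

include hT in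
/-- Let `F` be a complex of objects in `P`, with maps `F n ⟶ Q n` inducing isomorphisms between
the homology of `F` and `Q n`. Then the homology of `Ψ F` is the direct sum of the
`T i (Q j)`. -/
theorem DimensionShift.homology_iso_diagonalSum (p : ℕ) : ∀ (F : ChainComplex C ℕ)
    (_ : ∀ n, P (F.X n)) (Q : ℕ → C) (φ : ∀ n, F.X n ⟶ Q n)
    (hφ : ∀ n, F.d (n + 1) n ≫ φ n = 0)
    (_ : (ShortComplex.mk _ _ (hφ 0)).Exact) (_ : Epi (φ 0))
    (_ : ∀ n, IsIso ((F.sc' (n + 2) (n + 1) n).homologyι ≫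
      (F.sc' (n + 2) (n + 1) n).descOpcycles (φ (n + 1)) (hφ (n + 1)))),
    Nonempty (((Ψ.mapHomologicalComplex _).obj F).homology p ≅ diagonalSum T p Q) := by
  induction p with
  | zero =>
    intro F hF Q φ hφ hex hepi hiso
    obtain ⟨h₁, h₂⟩ := exact_map_and_epi Ψ hex
    obtain ⟨e⟩ := nonempty_homology_zero_iso ((Ψ.mapHomologicalComplex _).obj F)
      (Ψ.map (φ 0)) _ h₁ h₂
    exact ⟨e ≪≫ (hT.zero _).some.symm⟩
  | succ p ih =>
    intro F hF Q φ hφ hex hepi hiso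
    have hY := kernelSequence_shortExact (φ 0)
    have := hiso 0
    obtain ⟨e, he⟩ := opcycles_iso_biprod (F.sc' 2 1 0) (φ 1) (hφ 1) (kernel.ι (φ 0)) hY.mono_f (φ 0)
      (kernel.condition _) hY.exact (hφ 0) hex
    -- Total degree 1 is separate: the truncated complex forgets `F_1 ⟶ F_0`, so its homology in
    -- degree 0 is not that of `Ψ F` in degree 1.
    match p with
    | 0 =>
      obtain ⟨a⟩ := homology_map_iso_biprod Ψ (F.sc' 2 1 0) (kernel.ι (φ 0)) e he
      exact ⟨((Ψ.mapHomologicalComplex _).obj F).homologyIsoSc' 2 1 0 (by simp) (by simp) ≪≫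
        a ≪≫ (biprod.braiding _ _) ≪≫
        biprod.mapIso (hT.one _ hY (hF 0)).some.symm (hT.zero _).some.symm⟩
    | p + 1 =>
      -- The new bottom homology is `opcycles`, that is `Q 1 ⊞ Y` with `Y` the kernel of `φ 0`; the
      -- higher `Q` are only reindexed.
      obtain ⟨a⟩ := ih (ChainComplex.truncate.obj F) (fun n => hF (n + 1))
        (fun n => n.casesOn (F.sc' 2 1 0).opcycles fun n => Q (n + 2))
        (fun n => n.casesOn (F.sc' 2 1 0).pOpcycles fun n => φ (n + 2))
        (fun n => n.casesOn (F.sc' 2 1 0).f_pOpcycles fun n => hφ (n + 2))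
        (ShortComplex.exact_of_g_is_cokernel _ (F.sc' 2 1 0).opcyclesIsCokernel)
        (inferInstanceAs (Epi (F.sc' 2 1 0).pOpcycles)) (fun n => hiso (n + 1))
      have b : ((Ψ.mapHomologicalComplex _).obj F).homology (p + 2) ≅
          ((Ψ.mapHomologicalComplex _).obj (ChainComplex.truncate.obj F)).homology (p + 1) :=
        ((Ψ.mapHomologicalComplex _).obj F).homologyIsoSc' (p + 3) (p + 2) (p + 1)
          (by simp) (by simp) ≪≫
        (((Ψ.mapHomologicalComplex _).obj (ChainComplex.truncate.obj F)).homologyIsoSc'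
          (p + 2) (p + 1) p (by simp) (by simp)).symm
      let D := diagonalSum T p fun n => Q (n + 2)
      -- The summand `T (p + 1) Y` shifts to `T (p + 2) (Q 0)`, because `Y` is a syzygy of `Q 0`.
      have c : T (p + 1) (F.sc' 2 1 0).opcycles ⊞ D ≅ T (p + 2) (Q 0) ⊞ (T (p + 1) (Q 1) ⊞ D) :=
        biprod.mapIso ((hT.iso e _).some ≪≫ (hT.biprod_iso _ _ _).some ≪≫
          biprod.mapIso (Iso.refl _) (hT.succ _ p hY (hF 0)).some.symm ≪≫ biprod.braiding _ _)
          (Iso.refl _) ≪≫ biprod.associator _ _ _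
      exact ⟨b ≪≫ a ≪≫ c⟩

end DimensionShifting

/-! ### Formal complexes and resolutions -/

section DimensionShiftingResolutions

open scoped ZeroObject

variable {C : Type*} [Category* C] [Abelian C] {A : Type*} [Category* A] [Abelian A]

/-- Adding a zero object does not change an object. -/
def biprod_iso_of_isZero {Z : A} (X : A) (hZ : IsZero Z) : X ⊞ Z ≅ X where
  hom := biprod.fst
  inv := biprod.inl
  hom_inv_id := biprod.hom_ext' _ _ (by simp) (hZ.eq_of_src _ _)
  inv_hom_id := biprod.inl_fst

/-- With zero maps the homology of `S'` is `S'.X₂`, and the composite becomes the map induced by `α`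
on homology. -/
lemma isIso_homologyι_descOpcycles_of_quasiIso {S S' : ShortComplex C} (α : S ⟶ S')
    (hα : ShortComplex.QuasiIso α) (hf : S'.f = 0) (hg : S'.g = 0) (h : S.f ≫ α.τ₂ = 0) :
    IsIso (S.homologyι ≫ S.descOpcycles α.τ₂ h) := by
  have h₁ : IsIso S'.homologyι := S'.isIso_homologyι hg
  have h₂ : IsIso S'.pOpcycles := S'.isIso_pOpcycles hf
  have h₃ : S.descOpcycles α.τ₂ h = ShortComplex.opcyclesMap α ≫ inv S'.pOpcycles := by
    rw [IsIso.eq_comp_inv, ← cancel_epi S.pOpcycles]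
    simp
  rw [h₃, ← Category.assoc, ← ShortComplex.homologyι_naturality]
  have := hα.isIso
  infer_instance

variable {Ψ : C ⥤ A} {P : C → Prop} {T : ℕ → C → A} (hT : DimensionShift Ψ P T)
  [Ψ.Additive] [PreservesFiniteColimits Ψ]
include hT

/-- If a complex `F` of objects in `P` is quasi-isomorphic to a complex `K` with zero
differential, the homology of `Ψ F` is the direct sum of the `T i (K j)`. -/
theorem DimensionShift.homology_iso_of_quasiIso {F K : ChainComplex C ℕ} (hF : ∀ n, P (F.X n))
    (φ : F ⟶ K) [QuasiIso φ] (hK : ∀ n, K.d (n + 1) n = 0) (p : ℕ) :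
    Nonempty (((Ψ.mapHomologicalComplex _).obj F).homology p ≅ diagonalSum T p K.X) := by
  have h₀ : (ShortComplex.mk (F.d 1 0) (φ.f 0) (by simp [← φ.comm, hK])).Exact ∧
      Epi (φ.f 0) := by
    have := (ChainComplex.quasiIsoAt₀_iff φ).1 inferInstance
    rwa [ShortComplex.quasiIso_iff_of_zeros'] at this
    · exact F.shape _ _ (by simp)
    · exact hK 0
    · exact K.shape _ _ (by simp)
  refine hT.homology_iso_diagonalSum p F hF K.X (fun n => φ.f n) (fun n => by
    rw [← φ.comm, hK, comp_zero]) h₀.1 h₀.2 fun n => ?_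
  exact isIso_homologyι_descOpcycles_of_quasiIso
    ((HomologicalComplex.shortComplexFunctor' C _ (n + 2) (n + 1) n).map φ)
    ((quasiIsoAt_iff' φ (n + 2) (n + 1) n (by simp) (by simp)).1 inferInstance)
    (hK _) (hK _) _

omit [PreservesFiniteColimits Ψ] in
-- The two claims feed each other: `0 ⟶ F ⟶ F ⟶ 0 ⟶ 0` shifts the vanishing from `F` to the zero
-- object, and `0 ⟶ 0 ⟶ F ⟶ F ⟶ 0` shifts it back.
lemma DimensionShift.isZero_succ (n : ℕ) :
    (∀ Z : C, IsZero Z → IsZero (T (n + 1) Z)) ∧ ∀ F : C, P F → IsZero (T (n + 1) F) := by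
  have h₁ (F : C) (hF : P F) (Z : C) (hZ : IsZero Z) :
      (ShortComplex.mk (0 : Z ⟶ F) (𝟙 F) (by simp)).ShortExact :=
    ShortComplex.Splitting.shortExact
      { r := 0
        s := 𝟙 F
        f_r := hZ.eq_of_src _ _ }
  have h₂ (F Z : C) (hZ : IsZero Z) :
      (ShortComplex.mk (𝟙 F) (0 : F ⟶ Z) (by simp)).ShortExact :=
    ShortComplex.Splitting.shortExact
      { r := 𝟙 F
        s := 0
        s_g := hZ.eq_of_src _ _ }
  induction n with
  | zero =>
    constructor
    · intro Z hZ
      obtain ⟨F, p, hF, -⟩ := hT.enough Z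
      refine IsZero.of_iso ?_ (hT.one _ (h₂ F Z hZ) hF).some
      have : IsIso (Ψ.map (𝟙 F)) := inferInstance
      exact isZero_kernel_of_mono _
    · intro F hF
      refine IsZero.of_iso ?_ (hT.one _ (h₁ F hF 0 (isZero_zero C)) hF).some
      exact IsZero.of_mono (kernel.ι _) (Ψ.map_isZero (isZero_zero C))
  | succ n ih =>
    constructor
    · intro Z hZ
      obtain ⟨F, p, hF, -⟩ := hT.enough Z
      exact (ih.2 F hF).of_iso (hT.succ _ n (h₂ F Z hZ) hF).some
    · intro F hF
      exact (ih.1 0 (isZero_zero C)).of_iso (hT.succ _ n (h₁ F hF 0 (isZero_zero C)) hF).some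

omit [PreservesFiniteColimits Ψ] in
lemma DimensionShift.isZero_of_isZero (n : ℕ) {Z : C} (hZ : IsZero Z) : IsZero (T n Z) := by
  match n with
  | 0 => exact (Ψ.map_isZero hZ).of_iso (hT.zero Z).some
  | n + 1 => exact (hT.isZero_succ n).1 Z hZ

omit [PreservesFiniteColimits Ψ] in
lemma DimensionShift.isZero_diagonalSum (p : ℕ) : ∀ (Q : ℕ → C) (_ : ∀ n, IsZero (Q n)),
    IsZero (diagonalSum T p Q) := by
  induction p with
  | zero => exact fun Q hQ => hT.isZero_of_isZero 0 (hQ 0)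
  | succ p ih =>
    intro Q hQ
    have h₁ := hT.isZero_of_isZero (p + 1) (hQ 0)
    have h₂ := ih (fun n => Q (n + 1)) fun n => hQ (n + 1)
    exact (biprod_isZero_iff _ _).2 ⟨h₁, h₂⟩

omit [PreservesFiniteColimits Ψ] in
lemma DimensionShift.diagonalSum_iso (p : ℕ) (Q : ℕ → C) (hQ : ∀ n, IsZero (Q (n + 1))) :
    Nonempty (diagonalSum T p Q ≅ T p (Q 0)) := by
  match p with
  | 0 => exact ⟨Iso.refl _⟩
  | p + 1 =>
    have h := hT.isZero_diagonalSum p (fun n => Q (n + 1)) hQ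
    exact ⟨biprod_iso_of_isZero (T (p + 1) (Q 0)) h⟩

/-- The operations `T p` can be computed using resolutions by objects in `P`. -/
theorem DimensionShift.homology_iso_of_resolution {F : ChainComplex C ℕ} (hF : ∀ n, P (F.X n))
    {X : C} (π : F ⟶ (ChainComplex.single₀ C).obj X) [QuasiIso π] (p : ℕ) :
    Nonempty (((Ψ.mapHomologicalComplex _).obj F).homology p ≅ T p X) := by
  obtain ⟨a⟩ := hT.homology_iso_of_quasiIso hF π (fun n => rfl) p
  obtain ⟨b⟩ := hT.diagonalSum_iso p ((ChainComplex.single₀ C).obj X).X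
    (fun n => HomologicalComplex.isZero_single_obj_X _ _ _ _ (by simp))
  obtain ⟨c⟩ := hT.iso (HomologicalComplex.singleObjXSelf (.down ℕ) 0 X) p
  exact ⟨a ≪≫ b ≪≫ c⟩

omit [Ψ.Additive] [PreservesFiniteColimits Ψ] in
lemma DimensionShift.diagonalSum_congr (p : ℕ) : ∀ {Q Q' : ℕ → C} (_ : ∀ n, Q n ≅ Q' n),
    Nonempty (diagonalSum T p Q ≅ diagonalSum T p Q') := by
  induction p with
  | zero => exact fun e => hT.iso (e 0) 0
  | succ p ih => exact fun e => ⟨biprod.mapIso (hT.iso (e 0) (p + 1)).some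
      (ih fun n => e (n + 1)).some⟩

end DimensionShiftingResolutions

/-! ### Left derived functors by splicing resolutions -/

section LeftDerived

variable {C : Type*} [Category* C] [Abelian C] {A : Type*} [Category* A] [Abelian A]

/-- The augmentation of a projective resolution. -/
def augmentation {X : C} (L : ProjectiveResolution X) : L.complex.X 0 ⟶ X := L.π.f 0

lemma d_augmentation {X : C} (L : ProjectiveResolution X) :
    L.complex.d 1 0 ≫ augmentation L = 0 := L.complex_d_comp_π_f_zero

lemma exact_augmentation {X : C} (L : ProjectiveResolution X) :
    (ShortComplex.mk _ _ (d_augmentation L)).Exact := L.exact₀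

instance {X : C} (L : ProjectiveResolution X) : Epi (augmentation L) :=
  inferInstanceAs (Epi (L.π.f 0))

/-- Splicing a projective resolution of `X₁` with a short exact sequence
`0 ⟶ X₁ ⟶ X₂ ⟶ X₃ ⟶ 0`. -/
def splicedComplex (S : ShortComplex C) (L : ProjectiveResolution S.X₁) : ChainComplex C ℕ :=
  L.complex.augment (augmentation L ≫ S.f) (by
    rw [← Category.assoc, d_augmentation, zero_comp])

lemma splicedComplex_d_comp (S : ShortComplex C) (L : ProjectiveResolution S.X₁) :
    (splicedComplex S L).d 1 0 ≫ S.g = 0 :=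
  (Category.assoc (augmentation L) S.f S.g).trans
    ((congrArg (augmentation L ≫ ·) S.zero).trans comp_zero)

/-- A splice of a projective resolution of `X₁` with a short exact sequence
`0 ⟶ X₁ ⟶ X₂ ⟶ X₃ ⟶ 0` with `X₂` projective is a projective resolution of `X₃`. -/
def splicedResolution {S : ShortComplex C} (hS : S.ShortExact) (hP : Projective S.X₂)
    (L : ProjectiveResolution S.X₁) : ProjectiveResolution S.X₃ where
  complex := splicedComplex S L
  projective n := match n with
    | 0 => hP
    | n + 1 => L.projective n
  π := (ChainComplex.toSingle₀Equiv (splicedComplex S L) S.X₃).symm ⟨S.g, splicedComplex_d_comp S L⟩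
  quasiIso := by
    have hmono := hS.mono_f
    have hepi := hS.epi_g
    refine ⟨fun n => ?_⟩
    match n with
    | 0 =>
      rw [ChainComplex.quasiIsoAt₀_iff, ShortComplex.quasiIso_iff_of_zeros']
      · refine (ShortComplex.exact_and_epi_g_iff_of_iso
          (S₂ := ShortComplex.mk (augmentation L ≫ S.f) S.g (by simp)) ?_).2 ⟨?_, hepi⟩
        · refine ShortComplex.isoMk (Iso.refl _) (Iso.refl _) (Iso.refl _) ?_ ?_
          · exact (Category.id_comp _).trans (Category.comp_id _).symm
          · have h : (((splicedComplex S L).toSingle₀Equiv S.X₃).symm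
                ⟨S.g, splicedComplex_d_comp S L⟩).f 0 = S.g :=
              ChainComplex.toSingle₀Equiv_symm_apply_f_zero (C := splicedComplex S L) S.g
                (splicedComplex_d_comp S L)
            exact (Category.id_comp S.g).trans (h.symm.trans (Category.comp_id _).symm)
        · let α : ShortComplex.mk (augmentation L ≫ S.f) S.g (by simp) ⟶ S :=
            { τ₁ := augmentation L
              τ₂ := 𝟙 _
              τ₃ := 𝟙 _ }
          have : Epi α.τ₁ := inferInstanceAs (Epi (augmentation L))
          have : IsIso α.τ₂ := inferInstanceAs (IsIso (𝟙 _))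
          have : Mono α.τ₃ := inferInstanceAs (Mono (𝟙 _))
          exact (ShortComplex.exact_iff_of_epi_of_isIso_of_mono α).2 hS.exact
      all_goals rfl
    | 1 =>
      rw [quasiIsoAt_iff_exactAt' _ _ (ChainComplex.exactAt_succ_single_obj _ _),
        HomologicalComplex.exactAt_iff' _ 2 1 0 (by simp) (by simp)]
      -- At the splice, composing the augmentation with the monomorphism `S.f` does not change its
      -- kernel.
      let α : ShortComplex.mk _ _ (d_augmentation L) ⟶ (splicedComplex S L).sc' 2 1 0 :=
        { τ₁ := 𝟙 (L.complex.X 1)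
          τ₂ := 𝟙 (L.complex.X 0)
          τ₃ := S.f
          comm₁₂ := (Category.id_comp _).trans (Category.comp_id _).symm
          comm₂₃ := Category.id_comp _ }
      have : Epi α.τ₁ := inferInstanceAs (Epi (𝟙 _))
      have : IsIso α.τ₂ := inferInstanceAs (IsIso (𝟙 _))
      have : Mono α.τ₃ := hmono
      exact (ShortComplex.exact_iff_of_epi_of_isIso_of_mono α).1 (exact_augmentation L)
    | n + 2 =>
      rw [quasiIsoAt_iff_exactAt' _ _ (ChainComplex.exactAt_succ_single_obj _ _),
        HomologicalComplex.exactAt_iff' _ (n + 3) (n + 2) (n + 1) (by simp) (by simp)]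
      exact L.exact_succ n

variable [EnoughProjectives C]

/-- Compute `X₃` with the spliced resolution: above the splice its homology is that of the
resolution of `X₁`, shifted by one. At the splice, right exactness turns it into the kernel of `Ψ X₁
⟶ Ψ X₂`. -/
theorem dimensionShift_leftDerived (Ψ : C ⥤ A) [Ψ.Additive] [PreservesFiniteColimits Ψ] :
    DimensionShift Ψ Projective fun n X => (Ψ.leftDerived n).obj X where
  enough X := ⟨Projective.over X, Projective.π X, inferInstance, inferInstance⟩
  biprod X Y _ _ := inferInstance
  zero X := ⟨Ψ.leftDerivedZeroIsoSelf.app X⟩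
  one S hS hP := by
    let L := projectiveResolution S.X₁
    let L' := splicedResolution hS hP L
    have := (inferInstance : Epi (augmentation L))
    obtain ⟨h₁, h₂⟩ := exact_map_and_epi Ψ (exact_augmentation L)
    obtain ⟨a⟩ := nonempty_homology_iso_kernel ((L'.complex.sc' 2 1 0).map Ψ)
      (Ψ.map (augmentation L)) _ h₁ h₂ (Ψ.map S.f) (Ψ.map_comp _ _).symm
    exact ⟨L'.isoLeftDerivedObj Ψ 1 ≪≫
      ((Ψ.mapHomologicalComplex _).obj L'.complex).homologyIsoSc' 2 1 0 (by simp) (by simp) ≪≫ a⟩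
  succ S n hS hP := by
    let L := projectiveResolution S.X₁
    let L' := splicedResolution hS hP L
    exact ⟨L'.isoLeftDerivedObj Ψ (n + 2) ≪≫
      ((Ψ.mapHomologicalComplex _).obj L'.complex).homologyIsoSc' (n + 3) (n + 2) (n + 1)
        (by simp) (by simp) ≪≫
      (((Ψ.mapHomologicalComplex _).obj L.complex).homologyIsoSc' (n + 2) (n + 1) n
        (by simp) (by simp)).symm ≪≫ (L.isoLeftDerivedObj Ψ (n + 1)).symm⟩

end LeftDerived

/-! ### Exactness in functor categories -/

section FunctorCategory

variable {E : Type*} [Category* E] {D : Type*} [Category* D] [Abelian D]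

lemma exact_of_exact_evaluation (S : ShortComplex (E ⥤ D))
    (h : ∀ e, (S.map ((evaluation E D).obj e)).Exact) : S.Exact := by
  rw [ShortComplex.exact_iff_isZero_homology, Functor.isZero_iff]
  intro e
  exact ((ShortComplex.exact_iff_isZero_homology _).1 (h e)).of_iso
    (S.mapHomologyIso ((evaluation E D).obj e)).symm

lemma nonempty_iso_kernel_of_evaluation {W X Y : E ⥤ D} (α : W ⟶ X) (β : X ⟶ Y)
    (hα : ∀ e, Mono (α.app e)) (w : α ≫ β = 0)
    (h : ∀ e, ((ShortComplex.mk α β w).map ((evaluation E D).obj e)).Exact) :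
    Nonempty (W ≅ kernel β) := by
  have : Mono α := NatTrans.mono_of_mono_app α
  have : Mono (ShortComplex.mk α β w).f := this
  exact ⟨(exact_of_exact_evaluation _ h).fIsKernel.conePointUniqueUpToIso (limit.isLimit _)⟩

end FunctorCategory

lemma comm_of_comm₃ {C : Type*} [Category* C] {X Y Z W X' Y' Z' W' : C} {a : X ⟶ X'} {b : Y ⟶ Y'}
    {c : Z ⟶ Z'} {d : W ⟶ W'} {f : X ⟶ Y} {g : Y ⟶ Z} {h : Z ⟶ W} {f' : X' ⟶ Y'} {g' : Y' ⟶ Z'}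
    {h' : Z' ⟶ W'} (h₁ : a ≫ f' = f ≫ b) (h₂ : g ≫ c = b ≫ g') (h₃ : h ≫ d = c ≫ h') :
    a ≫ f' ≫ g' ≫ h' = (f ≫ g ≫ h) ≫ d := by
  rw [reassoc_of% h₁, Category.assoc, Category.assoc, h₃, reassoc_of% h₂]

lemma nonempty_exact_of_iso {D : Type*} [Category* D] [HasZeroMorphisms D] {X Y Z X' Y' Z' : D}
    {f : X ⟶ Y} {g : Y ⟶ Z} {w : f ≫ g = 0} (h : (ShortComplex.mk f g w).Exact)
    (a : X' ≅ X) (b : Y' ≅ Y) (c : Z' ≅ Z) {g' : Y' ⟶ Z'} (hg : b.inv ≫ g' = g ≫ c.inv) :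
    ∃ w', (ShortComplex.mk (a.hom ≫ f ≫ b.inv) g' w').Exact := by
  have w' : (a.hom ≫ f ≫ b.inv) ≫ g' = 0 := by
    rw [Category.assoc, Category.assoc, hg, reassoc_of% w, zero_comp, comp_zero]
  refine ⟨w', (ShortComplex.exact_iff_of_iso
    (ShortComplex.isoMk a b c ?_ ?_ : ShortComplex.mk _ _ w' ≅ ShortComplex.mk f g w)).2 h⟩
  · simp
  · simp [← cancel_epi b.inv, ← cancel_mono c.inv, hg]

/-! ### The long exact sequence for a short exact sequence of functors -/

section LeftDerivedSequence

variable {C : Type*} [Category* C] [Abelian C] [EnoughProjectives C]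
  {D : Type*} [Category* D] [Abelian D] {F₁ F₂ F₃ : C ⥤ D}
  [F₁.Additive] [F₂.Additive] [F₃.Additive]

/-- Naturality in the functor, not in the object; it replaces a kernel taken on zeroth derived
functors by one taken on the functors themselves. -/
lemma leftDerived_zero_naturality {F G : C ⥤ D} [F.Additive] [G.Additive] (α : F ⟶ G) :
    NatTrans.leftDerived α 0 ≫ G.fromLeftDerivedZero = F.fromLeftDerivedZero ≫ α := by
  ext X
  let L := projectiveResolution X
  rw [NatTrans.comp_app, NatTrans.comp_app, L.leftDerived_app_eq α 0, L.fromLeftDerivedZero_eq F,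
    L.fromLeftDerivedZero_eq G]
  simp only [Category.assoc, Iso.inv_hom_id_assoc]
  congr 1
  have h : HomologicalComplex.opcyclesMap
      ((NatTrans.mapHomologicalComplex α (.down ℕ)).app L.complex) 0 ≫ L.fromLeftDerivedZero' G =
      L.fromLeftDerivedZero' F ≫ α.app X := by
    rw [← cancel_epi (HomologicalComplex.pOpcycles _ _)]
    rw [HomologicalComplex.p_opcyclesMap_assoc,
      ProjectiveResolution.pOpcycles_comp_fromLeftDerivedZero',
      ProjectiveResolution.pOpcycles_comp_fromLeftDerivedZero'_assoc]
    exact (α.naturality _).symm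
  exact (HomologicalComplex.homologyι_naturality_assoc _ _ _).trans
    ((congrArg (HomologicalComplex.homologyι _ 0 ≫ ·) h).trans (Category.assoc _ _ _).symm)

variable (f : F₁ ⟶ F₂) (g : F₂ ⟶ F₃) (w : f ≫ g = 0)

/-- The sequence of complexes `F₁ K ⟶ F₂ K ⟶ F₃ K`. -/
abbrev mapComplexSequence (K : ChainComplex C ℕ) : ShortComplex (ChainComplex D ℕ) :=
  ShortComplex.mk ((NatTrans.mapHomologicalComplex f _).app K)
    ((NatTrans.mapHomologicalComplex g _).app K) (by
      ext n
      exact NatTrans.congr_app w (K.X n))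

variable (hP : ∀ X : C, Projective X →
  (ShortComplex.mk (f.app X) (g.app X) (NatTrans.congr_app w X)).ShortExact)

omit [EnoughProjectives C] in
include hP in
lemma mapComplexSequence_shortExact {X : C} (L : ProjectiveResolution X) :
    (mapComplexSequence f g w L.complex).ShortExact :=
  HomologicalComplex.shortExact_of_degreewise_shortExact _ fun n => hP _ (L.projective n)

omit [EnoughProjectives C] in
include hP in
lemma mapComplexSequence_δ_naturality {X Y : C} (L : ProjectiveResolution X)
    (M : ProjectiveResolution Y) (φ : L.complex ⟶ M.complex) (n : ℕ) :
    (mapComplexSequence_shortExact f g w hP L).δ (n + 1) n rfl ≫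
        HomologicalComplex.homologyMap ((F₁.mapHomologicalComplex _).map φ) n =
      HomologicalComplex.homologyMap ((F₃.mapHomologicalComplex _).map φ) (n + 1) ≫
        (mapComplexSequence_shortExact f g w hP M).δ (n + 1) n rfl :=
  let Φ : mapComplexSequence f g w L.complex ⟶ mapComplexSequence f g w M.complex :=
    { τ₁ := (F₁.mapHomologicalComplex _).map φ
      τ₂ := (F₂.mapHomologicalComplex _).map φ
      τ₃ := (F₃.mapHomologicalComplex _).map φ
      comm₁₂ := by ext n; exact f.naturality _
      comm₂₃ := by ext n; exact g.naturality _ }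
  HomologicalComplex.HomologySequence.δ_naturality Φ
    (mapComplexSequence_shortExact f g w hP L)
    (mapComplexSequence_shortExact f g w hP M) (n + 1) n rfl

/-- The connecting homomorphism between left derived functors. -/
def leftDerivedδ (n : ℕ) : F₃.leftDerived (n + 1) ⟶ F₁.leftDerived n where
  app X := ((projectiveResolution X).isoLeftDerivedObj F₃ (n + 1)).hom ≫
    (mapComplexSequence_shortExact f g w hP (projectiveResolution X)).δ (n + 1) n rfl ≫
    ((projectiveResolution X).isoLeftDerivedObj F₁ n).inv
  naturality X Y a := by
    let φ := ProjectiveResolution.lift a (projectiveResolution X) (projectiveResolution Y)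
    have hφ : φ.f 0 ≫ (projectiveResolution Y).π.f 0 = (projectiveResolution X).π.f 0 ≫ a :=
      ProjectiveResolution.lift_commutes_zero _ _ _
    have h₁ := ProjectiveResolution.isoLeftDerivedObj_hom_naturality a _ _ φ hφ F₃ (n + 1)
    have h₂ := ProjectiveResolution.isoLeftDerivedObj_inv_naturality a _ _ φ hφ F₁ n
    have h₃ := mapComplexSequence_δ_naturality f g w hP _ _ φ n
    exact comm_of_comm₃ h₁ h₃ h₂

variable {E : Type*} [Category* E] (K : E ⥤ C)

include g w hP in
/-- If `0 ⟶ F₁ ⟶ F₂ ⟶ F₃ ⟶ 0` is exact on projective objects and the positive left derived functors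
of `F₂` vanish, then `L_{n+1} F₃` is the kernel of `L_n F₁ ⟶ L_n F₂`. -/
theorem leftDerived_succ_iso_kernel (h₂ : ∀ n X, IsZero ((F₂.leftDerived (n + 1)).obj X)) (n : ℕ) :
    Nonempty (K ⋙ F₃.leftDerived (n + 1) ≅
      kernel (Functor.whiskerLeft K (NatTrans.leftDerived f n))) := by
  have hex (X : C) : ∃ w', (ShortComplex.mk ((leftDerivedδ f g w hP n).app X)
      ((NatTrans.leftDerived f n).app X) w').Exact := by
    let L := projectiveResolution X
    refine nonempty_exact_of_iso
      ((mapComplexSequence_shortExact f g w hP L).homology_exact₁ (n + 1) n rfl)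
      (L.isoLeftDerivedObj F₃ (n + 1)) (L.isoLeftDerivedObj F₁ n) (L.isoLeftDerivedObj F₂ n) ?_
    exact (Iso.inv_comp_eq (L.isoLeftDerivedObj F₁ n)).2 (L.leftDerived_app_eq f n)
  have hmono (X : C) : Mono ((leftDerivedδ f g w hP n).app X) := by
    let L := projectiveResolution X
    have h := (mapComplexSequence_shortExact f g w hP L).homology_exact₃ (n + 1) n rfl
    have : Mono ((mapComplexSequence_shortExact f g w hP L).δ (n + 1) n rfl) :=
      h.mono_g (((h₂ n X).of_iso (L.isoLeftDerivedObj F₂ (n + 1)).symm).eq_of_src _ _)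
    have h₁ : Mono (L.isoLeftDerivedObj F₁ n).inv := inferInstance
    exact mono_comp' (inferInstanceAs (Mono (L.isoLeftDerivedObj F₃ (n + 1)).hom))
      (mono_comp' this h₁)
  refine nonempty_iso_kernel_of_evaluation
    (Functor.whiskerLeft K (leftDerivedδ f g w hP n)) _ (fun e => hmono _) ?_ ?_
  · ext e
    exact (hex _).choose
  · exact fun e => (hex (K.obj e)).choose_spec

end LeftDerivedSequence

/-! ### Tor over a group ring: dimension shifting in the first variable -/

section Tor

open MonoidalCategory

variable {J H : Type u} [CommRing J] [Group H]

/-- Tensoring with the free module on `α` gives `α →₀ X`, where `f` acts coordinatewise. -/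
lemma mono_tensor_free {X Y : Rep.{u} J H} (f : X ⟶ Y) [Mono f] (α : Type u) :
    Mono (((Rep.coinvariantsTensor J H).map f).app (Rep.free J H α)) := by
  classical
  let i (Z : Rep.{u} J H) : ((Rep.coinvariantsTensor J H).obj Z).obj (Rep.free J H α) ≅
      ModuleCat.of J (α →₀ Z) := (Rep.coinvariantsTensorFreeLEquiv Z α).toModuleIso
  let g : ModuleCat.of J (α →₀ X) ⟶ ModuleCat.of J (α →₀ Y) :=
    ModuleCat.ofHom (Finsupp.mapRange.linearMap f.hom.toLinearMap)
  have h : (i X).inv ≫ ((Rep.coinvariantsTensor J H).map f).app (Rep.free J H α) =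
      g ≫ (i Y).inv := by
    ext a x : 3
    change (((Rep.coinvariantsTensor J H).map f).app (Rep.free J H α)).hom
      (Rep.finsuppToCoinvariantsTensorFree X α (Finsupp.single a x)) =
      Rep.finsuppToCoinvariantsTensorFree Y α
        (Finsupp.mapRange f.hom.toLinearMap (map_zero _) (Finsupp.single a x))
    rw [Finsupp.mapRange_single]
    erw [Rep.finsuppToCoinvariantsTensorFree_single, Rep.finsuppToCoinvariantsTensorFree_single]
    rfl
  have hg : Mono g := (ModuleCat.mono_iff_injective _).2
    (Finsupp.mapRange_injective _ (map_zero _) ((Rep.mono_iff_injective f).1 inferInstance))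
  have h' := (Iso.inv_comp_eq (i X)).1 h
  rw [h']
  exact mono_comp' inferInstance (mono_comp' hg inferInstance)

/-- A projective module is a retract of the free module on its underlying set. -/
lemma mono_tensor_projective {X Y : Rep.{u} J H} (f : X ⟶ Y) [Mono f] (L : Rep.{u} J H)
    [Projective L] : Mono (((Rep.coinvariantsTensor J H).map f).app L) := by
  let p : Rep.free J H L ⟶ L := Rep.freeLift J H L id
  have hp : Epi p := (Rep.epi_iff_surjective _).2 fun x =>
    ⟨Finsupp.single x (MonoidAlgebra.single 1 1), by simp [p]⟩
  let s : L ⟶ Rep.free J H L := Projective.factorThru (𝟙 L) p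
  have hs : s ≫ p = 𝟙 L := Projective.factorThru_comp _ _
  have h₁ : Mono (((Rep.coinvariantsTensor J H).obj X).map s) := by
    have : IsSplitMono (((Rep.coinvariantsTensor J H).obj X).map s) :=
      ⟨⟨⟨((Rep.coinvariantsTensor J H).obj X).map p, by rw [← Functor.map_comp, hs, CategoryTheory.Functor.map_id]⟩⟩⟩
    infer_instance
  have h₂ : ((Rep.coinvariantsTensor J H).obj X).map s ≫
      ((Rep.coinvariantsTensor J H).map f).app (Rep.free J H L) =
      ((Rep.coinvariantsTensor J H).map f).app L ≫ ((Rep.coinvariantsTensor J H).obj Y).map s :=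
    ((Rep.coinvariantsTensor J H).map f).naturality s
  have := mono_tensor_free f L
  have h₃ : Mono (((Rep.coinvariantsTensor J H).map f).app L ≫
    ((Rep.coinvariantsTensor J H).obj Y).map s) := h₂ ▸ mono_comp' h₁ this
  exact mono_of_mono _ (((Rep.coinvariantsTensor J H).obj Y).map s)

instance (X : Rep.{u} J H) : PreservesFiniteColimits ((Rep.coinvariantsTensor J H).obj X) :=
  inferInstanceAs (PreservesFiniteColimits (tensorLeft X ⋙ Rep.coinvariantsFunctor J H))

/-- The symmetry of the tensor product over `JH`. -/
def coinvariantsTensorFlipIso (X : Rep.{u} J H) :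
    (Rep.coinvariantsTensor J H).flip.obj X ≅ (Rep.coinvariantsTensor J H).obj X :=
  NatIso.ofComponents (fun Y => (Rep.coinvariantsFunctor J H).mapIso (β_ Y X)) (by
    intro Y Z f
    exact ((Rep.coinvariantsFunctor J H).map_comp _ _).symm.trans
      ((congrArg (Rep.coinvariantsFunctor J H).map
        (BraidedCategory.braiding_naturality_left f X)).trans
          ((Rep.coinvariantsFunctor J H).map_comp _ _)))

instance (X : Rep.{u} J H) : PreservesFiniteColimits ((Rep.coinvariantsTensor J H).flip.obj X) :=
  preservesFiniteColimits_of_natIso (coinvariantsTensorFlipIso X).symm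

instance (X : Rep.{u} J H) [Projective X] :
    ((Rep.coinvariantsTensor J H).obj X).PreservesMonomorphisms where
  preserves {Y Z} f _ := by
    have h : ((Rep.coinvariantsTensor J H).map f).app X ≫ (coinvariantsTensorFlipIso X).hom.app Z =
        (coinvariantsTensorFlipIso X).hom.app Y ≫ ((Rep.coinvariantsTensor J H).obj X).map f :=
      (coinvariantsTensorFlipIso X).hom.naturality f
    have := mono_tensor_projective f X
    rw [← Iso.app_hom, ← Iso.app_hom] at h
    rw [← (Iso.inv_comp_eq _).2 h]
    exact mono_comp' inferInstance (mono_comp' this inferInstance)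

instance : (Rep.coinvariantsTensor J H).Additive where
  map_add {X Y f g} := by
    ext Z : 2
    exact ((Rep.coinvariantsFunctor J H).congr_map (MonoidalPreadditive.add_whiskerRight _ _)).trans
      (Functor.map_add _)

instance (X : Rep.{u} J H) : ((Rep.coinvariantsTensor J H).flip.obj X).Additive where
  map_add {_ _ f g} := NatTrans.congr_app ((Rep.coinvariantsTensor J H).map_add (f := f) (g := g)) X

lemma isZero_Tor_succ (X Y : Rep.{u} J H) [Projective X] (n : ℕ) :
    IsZero (((Rep.Tor J H (n + 1)).obj X).obj Y) := by
  let Φ := (Rep.coinvariantsTensor J H).obj X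
  have : Φ.PreservesHomology := Φ.preservesHomology_of_preservesMonos_and_cokernels
  let L := projectiveResolution Y
  have h := (L.exact_succ n).map Φ
  refine IsZero.of_iso ?_ (Rep.torIso X L (n + 1) ≪≫
    HomologicalComplex.homologyIsoSc' _ (n + 2) (n + 1) n (by simp) (by simp))
  exact (ShortComplex.exact_iff_isZero_homology _).1 h

lemma coinvariantsTensor_shortExact {S : ShortComplex (Rep.{u} J H)} (hS : S.ShortExact)
    (X : Rep.{u} J H) [Projective X] :
    (ShortComplex.mk (((Rep.coinvariantsTensor J H).map S.f).app X)
      (((Rep.coinvariantsTensor J H).map S.g).app X)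
      (by rw [← NatTrans.comp_app, ← Functor.map_comp, S.zero, Functor.map_zero]; rfl)).ShortExact := by
  have hf := hS.mono_f
  have hg := hS.epi_g
  let Φ := (Rep.coinvariantsTensor J H).flip.obj X
  have h := exact_map_and_epi Φ hS.exact
  exact { exact := h.1
          mono_f := mono_tensor_projective S.f X
          epi_g := h.2 }

variable {E : Type*} [Category* E] (K : E ⥤ Rep.{u} J H)

/-- The functor sending `X` to `M ↦ X ⊗_{JH} K(M)`. -/
abbrev tensorFunctor : Rep.{u} J H ⥤ E ⥤ ModuleCat.{u} J :=
  Rep.coinvariantsTensor J H ⋙ (Functor.whiskeringLeft E _ (ModuleCat.{u} J)).obj K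

instance : PreservesFiniteColimits (tensorFunctor K) :=
  preservesFiniteColimits_of_evaluation _ fun e =>
    inferInstanceAs (PreservesFiniteColimits ((Rep.coinvariantsTensor J H).flip.obj (K.obj e)))

instance : (tensorFunctor K).Additive := inferInstanceAs (Functor.Additive (_ ⋙ _))

/-- `Rep.Tor` is derived in the second variable but is shifted here in the first. This needs the
balance of Tor: a short exact sequence in the first variable stays exact on projectives in the
second, and Tor vanishes when the first variable is projective. -/
theorem dimensionShift_tor :
    DimensionShift (tensorFunctor K) Projective fun n X => K ⋙ (Rep.Tor J H n).obj X where
  enough X := ⟨Projective.over X, Projective.π X, inferInstance, inferInstance⟩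
  biprod X Y _ _ := inferInstance
  zero X := ⟨Functor.isoWhiskerLeft K ((Rep.coinvariantsTensor J H).obj X).leftDerivedZeroIsoSelf⟩
  one S hS hP := by
    obtain ⟨a⟩ := leftDerived_succ_iso_kernel ((Rep.coinvariantsTensor J H).map S.f)
      ((Rep.coinvariantsTensor J H).map S.g)
      (by rw [← Functor.map_comp, S.zero, Functor.map_zero])
      (fun X _ => coinvariantsTensor_shortExact hS X) K (fun n X => isZero_Tor_succ S.X₂ X n) 0
    obtain ⟨b⟩ := nonempty_kernel_iso_of_comm
      (f := Functor.whiskerLeft K (NatTrans.leftDerived ((Rep.coinvariantsTensor J H).map S.f) 0))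
      (g := (tensorFunctor K).map S.f)
      (Functor.isoWhiskerLeft K ((Rep.coinvariantsTensor J H).obj S.X₁).leftDerivedZeroIsoSelf)
      (Functor.isoWhiskerLeft K ((Rep.coinvariantsTensor J H).obj S.X₂).leftDerivedZeroIsoSelf) (by
        ext e : 2
        exact NatTrans.congr_app (leftDerived_zero_naturality
          ((Rep.coinvariantsTensor J H).map S.f)) (K.obj e))
    exact ⟨a ≪≫ b⟩
  succ S n hS hP := by
    obtain ⟨a⟩ := leftDerived_succ_iso_kernel ((Rep.coinvariantsTensor J H).map S.f)
      ((Rep.coinvariantsTensor J H).map S.g)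
      (by rw [← Functor.map_comp, S.zero, Functor.map_zero])
      (fun X _ => coinvariantsTensor_shortExact hS X) K (fun n X => isZero_Tor_succ S.X₂ X n) (n + 1)
    have hz : IsZero (K ⋙ ((Rep.coinvariantsTensor J H).obj S.X₂).leftDerived (n + 1)) :=
      (Functor.isZero_iff _).2 fun e => isZero_Tor_succ S.X₂ (K.obj e) n
    have : Functor.whiskerLeft K
        (NatTrans.leftDerived ((Rep.coinvariantsTensor J H).map S.f) (n + 1)) = 0 :=
      hz.eq_of_tgt _ _
    exact ⟨a ≪≫ kernelIsoOfEq this ≪≫ kernelZeroIsoSource⟩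

end Tor

lemma DimensionShift.congr {C : Type*} [Category* C] [Abelian C] {A : Type*} [Category* A]
    [Abelian A] {Ψ : C ⥤ A} {P : C → Prop} {T T' : ℕ → C → A} (hT : DimensionShift Ψ P T)
    (h : ∀ n X, Nonempty (T n X ≅ T' n X)) : DimensionShift Ψ P T' where
  enough := hT.enough
  biprod := hT.biprod
  zero X := ⟨(h 0 X).some.symm ≪≫ (hT.zero X).some⟩
  one S hS hP := ⟨(h 1 _).some.symm ≪≫ (hT.one S hS hP).some⟩
  succ S n hS hP := ⟨(h _ _).some.symm ≪≫ (hT.succ S n hS hP).some ≪≫ (h _ _).some⟩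

/-! ### Derived functors with values in functor categories -/

section Pointwise

variable {E : Type*} [Category* E] {C : Type*} [Category* C] {D : Type*} [Category* D] [Abelian D]

/-- The homology of a complex of functors is computed pointwise. -/
def asFunctorHomologyIso (F : ChainComplex (E ⥤ D) ℕ) (n : ℕ) :
    F.asFunctor ⋙ HomologicalComplex.homologyFunctor D _ n ≅ F.homology n :=
  NatIso.ofComponents (fun e => (F.sc n).mapHomologyIso ((evaluation E D).obj e)) (by
    intro e e' f
    have h := NatTrans.app_homology ((evaluation E D).map f) (F.sc n)
    have h' := (Iso.eq_inv_comp _).1 h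
    exact h'.symm)

variable [Abelian C] [EnoughProjectives C] (Θ : E ⥤ C ⥤ D) [∀ e, (Θ.obj e).Additive]

instance : Θ.flip.Additive where
  map_add {X Y f g} := by
    ext e
    exact (Θ.obj e).map_add

/-- The functor sending `e` to the value at `X` of the `n`-th left derived functor of `Θ e`. -/
@[simps]
def pointwiseLeftDerived (n : ℕ) (X : C) : E ⥤ D where
  obj e := ((Θ.obj e).leftDerived n).obj X
  map f := (NatTrans.leftDerived (Θ.map f) n).app X
  map_id e := by rw [Θ.map_id, NatTrans.leftDerived_id]; rfl
  map_comp f g := by rw [Θ.map_comp, NatTrans.leftDerived_comp]; rfl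

/-- Left derived functors of functors with values in a functor category are computed pointwise. -/
def leftDerivedFlipIso (n : ℕ) (X : C) :
    (Θ.flip.leftDerived n).obj X ≅ pointwiseLeftDerived Θ n X :=
  (projectiveResolution X).isoLeftDerivedObj Θ.flip n ≪≫ (asFunctorHomologyIso _ n).symm ≪≫
    NatIso.ofComponents (fun e => ((projectiveResolution X).isoLeftDerivedObj (Θ.obj e) n).symm) (by
      intro e e' f
      have h := (projectiveResolution X).leftDerived_app_eq (Θ.map f) n
      have h' := (Iso.inv_comp_eq _).2 h
      exact h'.symm)

omit [Abelian D] [Abelian C] [EnoughProjectives C] [∀ e, (Θ.obj e).Additive] in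
lemma preservesFiniteColimits_flip [∀ e, PreservesFiniteColimits (Θ.obj e)] :
    PreservesFiniteColimits Θ.flip :=
  preservesFiniteColimits_of_evaluation _ fun e =>
    inferInstanceAs (PreservesFiniteColimits (Θ.obj e))

end Pointwise

/-! ### Ext as a left derived functor into the opposite category -/

section Ext

variable (J : Type*) [CommRing J] {C : Type*} [Category* C] [Abelian C] [Linear J C]
  {E : Type*} [Category* E] (K : E ⥤ C)

/-- The functor sending `N` and `X` to `Hom(X, K(N))`, with values in the opposite category of
modules. -/
def homFunctor : Eᵒᵖ ⥤ C ⥤ (ModuleCat J)ᵒᵖ where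
  obj N := ((linearYoneda J C).obj (K.obj N.unop)).rightOp
  map f := NatTrans.rightOp ((linearYoneda J C).map (K.map f.unop))

instance (X : C) : PreservesFiniteColimits ((linearYoneda J C).obj X).rightOp := by
  have : PreservesFiniteLimits ((linearYoneda J C).obj X) := by
    have : PreservesFiniteLimits ((linearYoneda J C).obj X ⋙ forget (ModuleCat J)) :=
      inferInstanceAs (PreservesFiniteLimits (yoneda.obj X))
    exact preservesFiniteLimits_of_reflects_of_preserves _ (forget (ModuleCat J))
  exact preservesFiniteColimits_rightOp _

instance (N : Eᵒᵖ) : ((homFunctor J K).obj N).Additive :=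
  inferInstanceAs (((linearYoneda J C).obj (K.obj N.unop)).rightOp).Additive

instance (N : Eᵒᵖ) : PreservesFiniteColimits ((homFunctor J K).obj N) :=
  inferInstanceAs (PreservesFiniteColimits ((linearYoneda J C).obj (K.obj N.unop)).rightOp)

instance : PreservesFiniteColimits (homFunctor J K).flip :=
  preservesFiniteColimits_flip (homFunctor J K)

variable [EnoughProjectives C]

theorem dimensionShift_ext :
    DimensionShift (homFunctor J K).flip Projective
      (pointwiseLeftDerived (homFunctor J K)) :=
  (dimensionShift_leftDerived _).congr fun n X => ⟨leftDerivedFlipIso _ n X⟩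

end Ext

/-! ### Coinvariants under the normal subgroup -/

section QuotientCoinvariants

variable {J G : Type u} [CommRing J] [Group G] (B : Subgroup G) [B.Normal]

/-- Coinvariants under a normal subgroup are left adjoint to inflation. -/
def quotientToCoinvariantsAdjunction :
    Rep.quotientToCoinvariantsFunctor.{u} J B ⊣ Rep.resFunctor (QuotientGroup.mk' B) where
  unit := { app X := Rep.ofHom ⟨Representation.Coinvariants.mk _, fun g => rfl⟩ }
  counit :=
    { app Y := Rep.ofHom ⟨Representation.Coinvariants.lift _ LinearMap.id fun b => by
          ext y
          change Y.ρ ((b : G) : G ⧸ B) y = y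
          rw [(QuotientGroup.eq_one_iff (b : G)).2 b.2, map_one]; rfl, fun g => by
            induction g using QuotientGroup.induction_on with
            | H g => ext; rfl⟩
      naturality X Y f := by
        ext x
        obtain ⟨x, rfl⟩ := Representation.Coinvariants.mk_surjective _ x
        rfl }
  left_triangle_components X := by
    ext x
    obtain ⟨x, rfl⟩ := Representation.Coinvariants.mk_surjective _ x
    rfl
  right_triangle_components Y := by ext; rfl

instance : (Rep.quotientToCoinvariantsFunctor.{u} J B).IsLeftAdjoint :=
  (quotientToCoinvariantsAdjunction B).isLeftAdjoint

instance : (Rep.quotientToCoinvariantsFunctor.{u} J B).Additive where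
  map_add {X Y f g} := by
    ext x
    obtain ⟨x, rfl⟩ := Representation.Coinvariants.mk_surjective _ x
    rfl

instance : (Rep.quotientToCoinvariantsFunctor.{u} J B).PreservesProjectiveObjects :=
  (Rep.quotientToCoinvariantsFunctor J B).preservesProjectiveObjects_of_adjunction_of_preservesEpimorphisms
    (quotientToCoinvariantsAdjunction B)

end QuotientCoinvariants

/-! ### Homology of the normal subgroup with its quotient action -/

section HomologyRep

variable {J G : Type u} [CommRing J] [Group G] (B : Subgroup G) [B.Normal]

/-- The endomorphism of the chain complex of `B` with coefficients in `A` given by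
`b ↦ g b g⁻¹` and `a ↦ g a`. -/
def conjChains (A : Rep.{u} J G) (g : G) :
    groupHomology.inhomogeneousChains (Rep.res B.subtype A) ⟶
      groupHomology.inhomogeneousChains (Rep.res B.subtype A) :=
  groupHomology.chainsMap (MulAut.conjNormal g : MulAut B).toMonoidHom
    (Rep.ofHom ⟨A.ρ g, fun b => by
      ext; simp [← Module.End.mul_apply, ← map_mul, MulAut.conjNormal_apply]⟩ :
      Rep.res B.subtype A ⟶ Rep.res (MulAut.conjNormal g : MulAut B).toMonoidHom
        (Rep.res B.subtype A))

lemma conjChains_naturality {A C : Rep.{u} J G} (f : A ⟶ C) (g : G) :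
    conjChains B A g ≫
        groupHomology.chainsMap (MonoidHom.id B) ((Rep.resFunctor B.subtype).map f) =
      groupHomology.chainsMap (MonoidHom.id B) ((Rep.resFunctor B.subtype).map f) ≫
        conjChains B C g := by
  rw [conjChains, conjChains, ← groupHomology.chainsMap_comp, ← groupHomology.chainsMap_comp]
  refine groupHomology.chainsMap_congr rfl ?_
  ext x
  exact Rep.hom_comm_apply f g x

/-- A map between homology modules compatible with the conjugation actions. -/
def homologyRepHom {A C : Rep.{u} J G} {n m : ℕ}
    (φ : groupHomology (Rep.res B.subtype A) n ⟶ groupHomology (Rep.res B.subtype C) m)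
    (h : ∀ g, conjMap B A n g ≫ φ = φ ≫ conjMap B C m g) :
    homologyRep B A n ⟶ homologyRep B C m :=
  Rep.ofHom ⟨φ.hom, fun x => by
    induction x using QuotientGroup.induction_on with
    | H g => exact congrArg ModuleCat.Hom.hom (h g)⟩

/-- The map `H_n(B, A) ⟶ H_n(B, C)` induced by `A ⟶ C`. -/
def homologyRepMap {A C : Rep.{u} J G} (f : A ⟶ C) (n : ℕ) :
    homologyRep B A n ⟶ homologyRep B C n :=
  homologyRepHom B
    ((groupHomology.functor J B n).map ((Rep.resFunctor B.subtype).map f)) fun g => by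
      have := congrArg (HomologicalComplex.homologyMap · n) (conjChains_naturality B f g)
      rw [HomologicalComplex.homologyMap_comp, HomologicalComplex.homologyMap_comp] at this
      exact this

/-- `H_0(B, A)` is the module of coinvariants. -/
def homologyRepZeroIso (A : Rep.{u} J G) :
    homologyRep B A 0 ≅ (Rep.quotientToCoinvariantsFunctor J B).obj A :=
  Rep.mkIso (.mk (groupHomology.H0Iso (Rep.res B.subtype A)).toLinearEquiv fun x => by
    induction x using QuotientGroup.induction_on with
    | H g =>
      have h : groupHomology.H0π (Rep.res B.subtype A) ≫ conjMap B A 0 g =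
          ModuleCat.ofHom (A.ρ g) ≫ groupHomology.H0π (Rep.res B.subtype A) :=
        groupHomology.H0π_comp_map _ _
      have h' : conjMap B A 0 g ≫ (groupHomology.H0Iso (Rep.res B.subtype A)).hom =
          (groupHomology.H0Iso (Rep.res B.subtype A)).hom ≫
            ModuleCat.ofHom ((A.ρ.toCoinvariants B) g) := by
        rw [← cancel_epi (groupHomology.H0π _), reassoc_of% h,
          groupHomology.H0π_comp_H0Iso_hom, groupHomology.H0π_comp_H0Iso_hom_assoc]
        rfl
      exact congrArg ModuleCat.Hom.hom h')

lemma homologyRepZeroIso_naturality {A C : Rep.{u} J G} (f : A ⟶ C) :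
    homologyRepMap B f 0 ≫ (homologyRepZeroIso B C).hom =
      (homologyRepZeroIso B A).hom ≫ (Rep.quotientToCoinvariantsFunctor J B).map f := by
  have h := groupHomology.map_id_comp_H0Iso_hom ((Rep.resFunctor B.subtype).map f)
  ext x
  exact congr(($h).hom x)

variable {S : ShortComplex (Rep.{u} J G)} (hS : S.ShortExact)

/-- The connecting homomorphism in the homology of a normal subgroup. -/
def homologyRepδ (n : ℕ) : homologyRep B S.X₃ (n + 1) ⟶ homologyRep B S.X₁ n :=
  homologyRepHom B (groupHomology.δ ((Rep.shortExact_res B.subtype).2 hS) (n + 1) n rfl) fun g => by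
    let T := (S.map (Rep.resFunctor B.subtype)).map (groupHomology.chainsFunctor J B)
    let φ : T ⟶ T :=
      { τ₁ := conjChains B _ g
        τ₂ := conjChains B _ g
        τ₃ := conjChains B _ g
        comm₁₂ := conjChains_naturality B _ g
        comm₂₃ := conjChains_naturality B _ g }
    exact (HomologicalComplex.HomologySequence.δ_naturality φ
      (groupHomology.map_chainsFunctor_shortExact ((Rep.shortExact_res B.subtype).2 hS))
      (groupHomology.map_chainsFunctor_shortExact ((Rep.shortExact_res B.subtype).2 hS))
      (n + 1) n rfl).symm

lemma isZero_groupHomology_succ {H : Type u} [Group H] (A : Rep.{u} J H) [Projective A] (n : ℕ) :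
    IsZero (groupHomology A (n + 1)) := by
  classical
  exact (isZero_Tor_succ A (Rep.trivial J H J) n).of_iso (groupHomologyIsoTor A (n + 1))

lemma isZero_homologyRep_succ (A : Rep.{u} J G)
    (hA : Projective ((Rep.resFunctor B.subtype).obj A)) (n : ℕ) :
    IsZero (homologyRep B A (n + 1)) := by
  have h := ModuleCat.isZero_iff_subsingleton.1
    (isZero_groupHomology_succ ((Rep.resFunctor B.subtype).obj A) n)
  exact (Rep.isZero_iff _ _ _).2 h

include hS in
-- Exactness over `J[G/B]` can be tested on underlying `J`-modules, where it is the long exact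
-- sequence of `H_*(B, -)`.
lemma exact_homologyRepδ (n : ℕ) :
    ∃ w, (ShortComplex.mk (homologyRepδ B hS n) (homologyRepMap B S.f n) w).Exact := by
  have h := groupHomology.mapShortComplex₁_exact ((Rep.shortExact_res B.subtype).2 hS)
    (j := n) rfl
  have w : homologyRepδ B hS n ≫ homologyRepMap B S.f n = 0 := by
    ext x
    exact congr(($((groupHomology.mapShortComplex₁ ((Rep.shortExact_res B.subtype).2 hS)
      (j := n) rfl).zero)).hom x)
  exact ⟨w, (forget₂ (Rep J (G ⧸ B)) (ModuleCat J)).reflects_exact_of_faithful _ h⟩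

include hS in
lemma mono_homologyRepδ (h₂ : Projective ((Rep.resFunctor B.subtype).obj S.X₂)) (n : ℕ) :
    Mono (homologyRepδ B hS n) := by
  have h := groupHomology.mono_δ_of_isZero ((Rep.shortExact_res B.subtype).2 hS) n
    (isZero_groupHomology_succ ((Rep.resFunctor B.subtype).obj S.X₂) n)
  exact (Rep.mono_iff_injective _).2 ((ModuleCat.mono_iff_injective _).1 h)

include hS in
lemma homologyRep_succ_iso_kernel (h₂ : Projective ((Rep.resFunctor B.subtype).obj S.X₂)) (n : ℕ) :
    Nonempty (homologyRep B S.X₃ (n + 1) ≅ kernel (homologyRepMap B S.f n)) := by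
  obtain ⟨w, h⟩ := exact_homologyRepδ B hS n
  have : Mono (ShortComplex.mk (homologyRepδ B hS n) (homologyRepMap B S.f n) w).f :=
    mono_homologyRepδ B hS h₂ n
  exact ⟨h.fIsKernel.conePointUniqueUpToIso (limit.isLimit _)⟩

/-- The acyclic class is that of `JG`-modules projective over `JB`, since the resolution `P` need
not be projective over `JG`. It is what yields `H_j(B, J)` from `P` together with its `G/B`-action.
-/
theorem dimensionShift_homologyRep :
    DimensionShift (Rep.quotientToCoinvariantsFunctor.{u} J B)
      (fun X => Projective ((Rep.resFunctor B.subtype).obj X)) fun n X => homologyRep B X n where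
  enough X := ⟨Projective.over X, Projective.π X,
    Functor.projective_obj_of_projective _ inferInstance, inferInstance⟩
  biprod X Y hX hY := by
    have := preservesBinaryBiproducts_of_preservesBiproducts (Rep.resFunctor (k := J) B.subtype)
    exact Projective.of_iso ((Rep.resFunctor B.subtype).mapBiprod X Y).symm inferInstance
  zero X := ⟨homologyRepZeroIso B X⟩
  one S hS hP := by
    obtain ⟨a⟩ := homologyRep_succ_iso_kernel B hS hP 0
    obtain ⟨b⟩ := nonempty_kernel_iso_of_comm (homologyRepZeroIso B S.X₁)
      (homologyRepZeroIso B S.X₂) (homologyRepZeroIso_naturality B S.f)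
    exact ⟨a ≪≫ b⟩
  succ S n hS hP := by
    obtain ⟨a⟩ := homologyRep_succ_iso_kernel B hS hP (n + 1)
    have : homologyRepMap B S.f (n + 1) = 0 := (isZero_homologyRep_succ B S.X₂ hP n).eq_of_tgt _ _
    exact ⟨a ≪≫ kernelIsoOfEq this ≪≫ kernelZeroIsoSource⟩

end HomologyRep

/-! ### Comparison of resolutions -/

section Resolutions

variable {C : Type*} [Category* C] [Abelian C]

lemma exact_and_epi_of_quasiIso {K : ChainComplex C ℕ} {X : C}
    (π : K ⟶ (ChainComplex.single₀ C).obj X) [QuasiIso π] :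
    (ShortComplex.mk (K.d 1 0) (π.f 0) (by rw [← π.comm]; exact comp_zero)).Exact ∧ Epi (π.f 0) := by
  have := (ChainComplex.quasiIsoAt₀_iff π).1 inferInstance
  rwa [ShortComplex.quasiIso_iff_of_zeros'] at this
  · exact K.shape _ _ (by simp)
  · rfl
  · rfl

lemma exact_succ_of_quasiIso {K : ChainComplex C ℕ} {X : C}
    (π : K ⟶ (ChainComplex.single₀ C).obj X) [QuasiIso π] (n : ℕ) :
    (ShortComplex.mk (K.d (n + 2) (n + 1)) (K.d (n + 1) n) (K.d_comp_d _ _ _)).Exact :=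
  (HomologicalComplex.exactAt_iff' _ (n + 2) (n + 1) n (by simp) (by simp)).1
    ((quasiIsoAt_iff_exactAt' π (n + 1) (ChainComplex.exactAt_succ_single_obj _ _)).1 inferInstance)

/-- Only the source has to be projective and only the target exact, so a resolution that is merely
`JB`-projective still receives a `JG`-linear map. -/
lemma exists_lift {F K : ChainComplex C ℕ} [∀ n, Projective (F.X n)] {X : C}
    (ρ : F ⟶ (ChainComplex.single₀ C).obj X) (π : K ⟶ (ChainComplex.single₀ C).obj X)
    [QuasiIso π] : ∃ φ : F ⟶ K, φ ≫ π = ρ := by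
  obtain ⟨h₀, hepi⟩ := exact_and_epi_of_quasiIso π
  let f₀ : F.X 0 ⟶ K.X 0 := Projective.factorThru (ρ.f 0) (π.f 0)
  have hf₀ : f₀ ≫ π.f 0 = ρ.f 0 := Projective.factorThru_comp _ _
  have hw : (F.d 1 0 ≫ f₀) ≫ π.f 0 = 0 := by
    rw [Category.assoc, hf₀, ← ρ.comm]; exact comp_zero
  let f₁ : F.X 1 ⟶ K.X 1 := h₀.liftFromProjective (F.d 1 0 ≫ f₀) hw
  have hf₁ : f₁ ≫ K.d 1 0 = F.d 1 0 ≫ f₀ := h₀.liftFromProjective_comp _ _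
  refine ⟨ChainComplex.mkHom _ _ f₀ f₁ hf₁ fun n ⟨g, g', w⟩ =>
    ⟨(exact_succ_of_quasiIso π n).liftFromProjective (F.d (n + 2) (n + 1) ≫ g') (by simp [w]),
      (exact_succ_of_quasiIso π n).liftFromProjective_comp _ _⟩, ?_⟩
  exact HomologicalComplex.to_single_hom_ext (by simpa using hf₀)

variable {D : Type*} [Category* D] [Abelian D]

/-- Any lift of the identity between projective resolutions is a homotopy equivalence, which every
additive functor preserves. -/
lemma quasiIso_map_of_resolutions {X : C} (L M : ProjectiveResolution X)
    (φ : L.complex ⟶ M.complex) (h : φ ≫ M.π = L.π) (Φ : C ⥤ D) [Φ.Additive] :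
    QuasiIso ((Φ.mapHomologicalComplex _).map φ) := by
  let e : HomotopyEquiv L.complex M.complex :=
    { hom := φ
      inv := (ProjectiveResolution.homotopyEquiv L M).inv
      homotopyHomInvId := ProjectiveResolution.liftHomotopy (𝟙 X) _ _ (by simp [h]) (by simp)
      homotopyInvHomId := ProjectiveResolution.liftHomotopy (𝟙 X) _ _ (by simp [h]) (by simp) }
  exact inferInstanceAs (QuasiIso (Φ.mapHomotopyEquiv e).hom)

/-- The image of a resolution under an exact functor, if it consists of projective objects. -/
def mapResolution (Φ : C ⥤ D) [Φ.Additive] [Φ.PreservesHomology] {K : ChainComplex C ℕ} {X : C}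
    (π : K ⟶ (ChainComplex.single₀ C).obj X) [QuasiIso π] (h : ∀ n, Projective (Φ.obj (K.X n))) :
    ProjectiveResolution (Φ.obj X) where
  complex := (Φ.mapHomologicalComplex _).obj K
  projective := h
  π := (Φ.mapHomologicalComplex _).map π ≫
    (HomologicalComplex.singleMapHomologicalComplex Φ (.down ℕ) 0).hom.app X

end Resolutions

section Quotient

variable {J G : Type u} [CommRing J] [Group G] (B : Subgroup G) [B.Normal]

/-- The homotopy inverse of `φ` exists over `JB` and need not be `G`-equivariant, but a
quasi-isomorphism can be tested after forgetting the `G/B`-action. -/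
lemma quasiIso_quotientToCoinvariants {F K : ChainComplex (Rep.{u} J G) ℕ} {X : Rep.{u} J G}
    (ρ : F ⟶ (ChainComplex.single₀ _).obj X) [QuasiIso ρ]
    (π : K ⟶ (ChainComplex.single₀ _).obj X) [QuasiIso π]
    (hF : ∀ n, Projective ((Rep.resFunctor B.subtype).obj (F.X n)))
    (hK : ∀ n, Projective ((Rep.resFunctor B.subtype).obj (K.X n))) (φ : F ⟶ K) (hφ : φ ≫ π = ρ) :
    QuasiIso (((Rep.quotientToCoinvariantsFunctor J B).mapHomologicalComplex _).map φ) := by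
  have h := quasiIso_map_of_resolutions (mapResolution (Rep.resFunctor B.subtype) ρ hF)
    (mapResolution (Rep.resFunctor B.subtype) π hK)
    (((Rep.resFunctor B.subtype).mapHomologicalComplex _).map φ)
    (by subst hφ; simp [mapResolution]) (Rep.coinvariantsFunctor J B)
  have h' : QuasiIso (((forget₂ (Rep J (G ⧸ B)) (ModuleCat J)).mapHomologicalComplex _).map
    (((Rep.quotientToCoinvariantsFunctor J B).mapHomologicalComplex _).map φ)) := h
  exact (HomologicalComplex.quasiIso_map_iff_of_preservesHomology _ _).1 h'

end Quotient

/-! ### Complexes with zero differential -/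

section ZeroDifferential

variable {A : Type*} [Category* A] [Abelian A]

/-- The homology of a short complex with zero maps. -/
def shortComplexHomologyIsoOfZero (S : ShortComplex A) (hf : S.f = 0) (hg : S.g = 0) : S.homology ≅ S.X₂ :=
  have := S.isIso_homologyι hg
  have := S.isIso_pOpcycles hf
  asIso S.homologyι ≪≫ (asIso S.pOpcycles).symm

/-- The homology of a complex with zero differential. -/
def homologyIsoOfZero (K : ChainComplex A ℕ) (hK : ∀ n, K.d (n + 1) n = 0) (n : ℕ) :
    K.homology n ≅ K.X n :=
  have hf : (K.sc n).f = 0 := by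
    have h : (ComplexShape.down ℕ).prev n = n + 1 := by simp
    change K.d ((ComplexShape.down ℕ).prev n) n = 0
    rw [h, hK]
  have hg : (K.sc n).g = 0 := by
    match n with
    | 0 => exact K.shape _ _ (by simp)
    | n + 1 =>
      have h : (ComplexShape.down ℕ).next (n + 1) = n := by simp
      change K.d (n + 1) ((ComplexShape.down ℕ).next (n + 1)) = 0
      rw [h, hK]
  shortComplexHomologyIsoOfZero (K.sc n) hf hg

end ZeroDifferential

/-! ### The coinvariant complex of a resolution -/

section Main

variable {J G : Type u} [CommRing J] [Group G] (B : Subgroup G) [B.Normal]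

/-- The complex of coinvariants under `B`, as a complex of modules over `J[G/B]`. -/
abbrev coinvariantsComplex (F : ChainComplex (Rep.{u} J G) ℕ) :
    ChainComplex (Rep.{u} J (G ⧸ B)) ℕ :=
  ((Rep.quotientToCoinvariantsFunctor J B).mapHomologicalComplex _).obj F

variable {P : ChainComplex (Rep.{u} J G) ℕ}
  (π : P ⟶ (ChainComplex.single₀ (Rep.{u} J G)).obj (Rep.trivial J G J)) [QuasiIso π]
  (hproj : ∀ j, Projective ((Rep.resFunctor B.subtype).obj (P.X j)))
  (hzero : ∀ j, (Rep.coinvariantsFunctor J B).map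
      ((Rep.resFunctor B.subtype).map (P.d (j + 1) j)) = 0)

include hzero in
lemma coinvariantsComplex_d_eq_zero (j : ℕ) : (coinvariantsComplex B P).d (j + 1) j = 0 := by
  ext x
  exact congr(($(hzero j)).hom x)

include π hproj hzero in
-- With zero differential each term is its own homology, and `P` computes `H_j(B, J)` because its
-- terms are projective over `JB`.
lemma coinvariantsComplex_iso_homologyRep (j : ℕ) :
    Nonempty ((coinvariantsComplex B P).X j ≅ homologyRep B (Rep.trivial J G J) j) := by
  obtain ⟨a⟩ := (dimensionShift_homologyRep B).homology_iso_of_resolution hproj π j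
  exact ⟨(homologyIsoOfZero _ (coinvariantsComplex_d_eq_zero B hzero) j).symm ≪≫ a⟩

include π hproj hzero in
/-- The homology of a right exact functor applied to the coinvariants of a projective resolution
of the trivial module is a direct sum. -/
theorem homology_coinvariantsComplex_iso {A : Type*} [Category* A] [Abelian A]
    {Ψ : Rep.{u} J (G ⧸ B) ⥤ A} [Ψ.Additive] [PreservesFiniteColimits Ψ]
    {T : ℕ → Rep.{u} J (G ⧸ B) → A} (hT : DimensionShift Ψ Projective T)
    (L : ProjectiveResolution (Rep.trivial J G J)) (p : ℕ) :
    Nonempty (((Ψ.mapHomologicalComplex _).obj (coinvariantsComplex B L.complex)).homology p ≅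
      diagonalSum T p fun j => homologyRep B (Rep.trivial J G J) j) := by
  obtain ⟨φ, hφ⟩ := exists_lift L.π π
  have hφ' := quasiIso_quotientToCoinvariants B L.π π
    (fun n => Functor.projective_obj_of_projective _ (L.projective n)) hproj φ hφ
  obtain ⟨a⟩ := hT.homology_iso_of_quasiIso
    (F := coinvariantsComplex B L.complex)
    (fun n => Functor.projective_obj_of_projective (Rep.quotientToCoinvariantsFunctor J B)
      (L.projective n))
    (((Rep.quotientToCoinvariantsFunctor J B).mapHomologicalComplex _).map φ)
    (coinvariantsComplex_d_eq_zero B hzero) p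
  obtain ⟨b⟩ := hT.diagonalSum_congr p
    fun n => (coinvariantsComplex_iso_homologyRep B π hproj hzero n).some
  exact ⟨a ≪≫ b⟩

end Main

/-! ### Group homology through coinvariants of the bar resolution -/

section Comparison

variable {J G : Type u} [CommRing J] [Group G] (B : Subgroup G) [B.Normal]

open TensorProduct

/-- The map `(M ⊗ X)_G ⟶ (X_B ⊗ M)_{G/B}` for a module `M` on which `B` acts trivially. -/
def tensorCoinvariantsHom (M : (trivialOn (J := J) B).FullSubcategory) (X : Rep.{u} J G) :
    ((Rep.coinvariantsTensor J G).obj M.obj).obj X ⟶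
      ((Rep.coinvariantsTensor J (G ⧸ B)).obj
        ((Rep.quotientToCoinvariantsFunctor J B).obj X)).obj ((toQuotient B).obj M) :=
  ModuleCat.ofHom <| Representation.Coinvariants.lift _
    (TensorProduct.lift ((Rep.coinvariantsTensorMk
      ((Rep.quotientToCoinvariantsFunctor J B).obj X) ((toQuotient B).obj M) ∘ₗ
        Representation.Coinvariants.mk (X.ρ.comp B.subtype)).flip)) fun g =>
      TensorProduct.ext' fun m x => Representation.Coinvariants.mk_self_apply
        (((Rep.quotientToCoinvariantsFunctor J B).obj X).ρ.tprod ((toQuotient B).obj M).ρ)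
        (g : G ⧸ B) (Representation.Coinvariants.mk (X.ρ.comp B.subtype) x ⊗ₜ[J] m)

/-- The map `X_B ⊗ M ⟶ (M ⊗ X)_G` for a module `M` on which `B` acts trivially. -/
def tensorCoinvariantsInvAux (M : (trivialOn (J := J) B).FullSubcategory) (X : Rep.{u} J G) :
    Representation.Coinvariants (X.ρ.comp B.subtype) →ₗ[J] M.obj →ₗ[J]
      ((Rep.coinvariantsTensor J G).obj M.obj).obj X :=
  Representation.Coinvariants.lift _ (Rep.coinvariantsTensorMk M.obj X).flip fun b => by
    ext x m
    have htriv : Representation.IsTrivial (M.obj.ρ.comp B.subtype) := inferInstance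
    have hm : M.obj.ρ b m = m := congr($(htriv.out b) m)
    refine Eq.trans ?_ (Representation.Coinvariants.mk_self_apply (M.obj.ρ.tprod X.ρ) b (m ⊗ₜ[J] x))
    exact congrArg (fun m' => Representation.Coinvariants.mk (M.obj.ρ.tprod X.ρ)
      (m' ⊗ₜ[J] X.ρ b x)) hm.symm

/-- The map `(X_B ⊗ M)_{G/B} ⟶ (M ⊗ X)_G` for a module `M` on which `B` acts trivially. -/
def tensorCoinvariantsInv (M : (trivialOn (J := J) B).FullSubcategory) (X : Rep.{u} J G) :
    ((Rep.coinvariantsTensor J (G ⧸ B)).obj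
        ((Rep.quotientToCoinvariantsFunctor J B).obj X)).obj ((toQuotient B).obj M) ⟶
      ((Rep.coinvariantsTensor J G).obj M.obj).obj X :=
  ModuleCat.ofHom <| Representation.Coinvariants.lift _
    (TensorProduct.lift (tensorCoinvariantsInvAux B M X)) fun g => by
      induction g using QuotientGroup.induction_on with
      | H g =>
        refine TensorProduct.ext' fun x m => ?_
        obtain ⟨x, rfl⟩ := Representation.Coinvariants.mk_surjective _ x
        exact Representation.Coinvariants.mk_self_apply (M.obj.ρ.tprod X.ρ) g (m ⊗ₜ[J] x)

/-- For a module `M` on which `B` acts trivially, `(M ⊗ X)_G` is `(X_B ⊗ M)_{G/B}`. -/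
def tensorCoinvariantsIso (M : (trivialOn (J := J) B).FullSubcategory) :
    (Rep.coinvariantsTensor J G).obj M.obj ≅
      Rep.quotientToCoinvariantsFunctor J B ⋙
        (Rep.coinvariantsTensor J (G ⧸ B)).flip.obj ((toQuotient B).obj M) :=
  NatIso.ofComponents (fun X =>
    { hom := tensorCoinvariantsHom B M X
      inv := tensorCoinvariantsInv B M X
      hom_inv_id := by
        refine Rep.coinvariantsTensor_hom_ext ?_
        ext m x
        rfl
      inv_hom_id := by
        refine Rep.coinvariantsTensor_hom_ext ?_
        refine LinearMap.ext fun x => LinearMap.ext fun m => ?_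
        obtain ⟨x, rfl⟩ := Representation.Coinvariants.mk_surjective _ x
        rfl }) (by
    intro X Y f
    refine Rep.coinvariantsTensor_hom_ext ?_
    ext m x
    rfl)

/-- The chains of a module on which `B` acts trivially can be computed after taking coinvariants
of the bar resolution. -/
def chainsIsoApp [DecidableEq G] (M : (trivialOn (J := J) B).FullSubcategory) :
    groupHomology.inhomogeneousChains M.obj ≅
      (((tensorFunctor (toQuotient (J := J) B)).mapHomologicalComplex _).obj
        (coinvariantsComplex B (Rep.barComplex J G))).asFunctor.obj M :=
  groupHomology.inhomogeneousChainsIso M.obj ≪≫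
    (NatIso.mapHomologicalComplex (tensorCoinvariantsIso B M) (.down ℕ)).app (Rep.barComplex J G)

lemma chainsIsoApp_hom_f_single [DecidableEq G] (M : (trivialOn (J := J) B).FullSubcategory)
    {n : ℕ} (a : Fin n → G) (m : M.obj) :
    ((chainsIsoApp B M).hom.f n).hom (Finsupp.single a m) =
      Rep.coinvariantsTensorMk
        ((Rep.quotientToCoinvariantsFunctor J B).obj (Rep.free J G (Fin n → G)))
        ((toQuotient B).obj M) (Representation.Coinvariants.mk _
          (Finsupp.single a (MonoidAlgebra.single (1 : G) (1 : J)))) m := by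
  change (tensorCoinvariantsHom B M (Rep.free J G (Fin n → G))).hom
    (Rep.finsuppToCoinvariantsTensorFree M.obj (Fin n → G) (Finsupp.single a m)) = _
  erw [Rep.finsuppToCoinvariantsTensorFree_single]
  rfl

/-- The chains of modules on which `B` acts trivially can be computed after taking coinvariants
of the bar resolution. -/
def chainsIso [DecidableEq G] :
    (trivialOn (J := J) B).ι ⋙ groupHomology.chainsFunctor J G ≅
      (((tensorFunctor (toQuotient (J := J) B)).mapHomologicalComplex _).obj
        (coinvariantsComplex B (Rep.barComplex J G))).asFunctor :=
  NatIso.ofComponents (chainsIsoApp B) (by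
      intro M N f
      ext n : 1
      -- A chain `single a m` corresponds to the class of the generator `a` of the bar complex
      -- tensored with `m`, so naturality in `m` is visible on such chains.
      refine ModuleCat.hom_ext (Finsupp.lhom_ext fun a m => ?_)
      have h : ((groupHomology.chainsMap (MonoidHom.id G) f.hom).f n).hom (Finsupp.single a m) =
          Finsupp.single a (f.hom.hom m) := groupHomology.chainsMap_f_single _ _ _ _ _
      refine (congrArg ((chainsIsoApp B N).hom.f n).hom h).trans
        ((chainsIsoApp_hom_f_single B N a (f.hom.hom m)).trans ?_)
      exact (congrArg (((((tensorFunctor (toQuotient (J := J) B)).mapHomologicalComplex _).obj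
        (coinvariantsComplex B (Rep.barComplex J G))).asFunctor.map f).f n).hom
          (chainsIsoApp_hom_f_single B M a m)).symm)

theorem groupHomology_iso (p : ℕ) : Nonempty
    ((trivialOn (J := J) B).ι ⋙ groupHomology.functor J G p ≅
      (((tensorFunctor (toQuotient (J := J) B)).mapHomologicalComplex _).obj
        (coinvariantsComplex B (Rep.barResolution J G).complex)).homology p) := by
  classical
  exact ⟨Functor.isoWhiskerRight (chainsIso B) (HomologicalComplex.homologyFunctor _ _ p) ≪≫
    asFunctorHomologyIso _ p⟩

end Comparison

/-! ### Group cohomology through coinvariants of the bar resolution -/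

section CohomologyComparison

variable {J G : Type u} [CommRing J] [Group G] (B : Subgroup G) [B.Normal]

/-- For a module `N` on which `B` acts trivially, `Hom_G(X, N)` is `Hom_{G/B}(X_B, N)`. -/
def homCoinvariantsIso (N : (trivialOn (J := J) B).FullSubcategory) :
    ((linearYoneda J (Rep.{u} J G)).obj N.obj).rightOp ≅
      Rep.quotientToCoinvariantsFunctor J B ⋙
        ((linearYoneda J (Rep.{u} J (G ⧸ B))).obj ((toQuotient B).obj N)).rightOp :=
  NatIso.ofComponents (fun X => Iso.op (LinearEquiv.toModuleIso
    { __ := (quotientToCoinvariantsAdjunction B).homEquiv X ((toQuotient B).obj N)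
      map_add' f g := rfl
      map_smul' r f := rfl })) (by
    intro X Y f
    refine Quiver.Hom.unop_inj ?_
    ext h
    rfl)

/-- The cochains of a module on which `B` acts trivially can be computed after taking coinvariants
of the bar resolution. -/
def cochainsIsoApp (N : (trivialOn (J := J) B).FullSubcategory) :
    (HomologicalComplex.opFunctor _ _).obj (.op (groupCohomology.inhomogeneousCochains N.obj)) ≅
      (((homFunctor J (toQuotient (J := J) B)).flip.mapHomologicalComplex _).obj
        (coinvariantsComplex B (Rep.barComplex J G))).asFunctor.obj (.op N) :=
  (HomologicalComplex.opFunctor _ _).mapIso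
      (groupCohomology.inhomogeneousCochainsIso N.obj).symm.op ≪≫
    (NatIso.mapHomologicalComplex (homCoinvariantsIso B N) (.down ℕ)).app (Rep.barComplex J G)

/-- The cochains of modules on which `B` acts trivially can be computed after taking coinvariants
of the bar resolution. -/
def cochainsIso :
    ((trivialOn (J := J) B).ι ⋙ groupCohomology.cochainsFunctor J G).op ⋙
        HomologicalComplex.opFunctor _ _ ≅
      (((homFunctor J (toQuotient (J := J) B)).flip.mapHomologicalComplex _).obj
        (coinvariantsComplex B (Rep.barComplex J G))).asFunctor :=
  NatIso.ofComponents (fun N => cochainsIsoApp B N.unop) (by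
    intro M N f
    ext n : 1
    refine Quiver.Hom.unop_inj ?_
    ext h
    rfl)

/-- Cohomology in the opposite category of modules. -/
def homologyOpIso {E D : Type*} [Category* E] [Category* D] [Abelian D]
    (K : E ⥤ CochainComplex D ℕ) (p : ℕ) :
    K.op ⋙ HomologicalComplex.opFunctor _ _ ⋙ HomologicalComplex.homologyFunctor _ _ p ≅
      (K ⋙ HomologicalComplex.homologyFunctor _ _ p).op :=
  NatIso.ofComponents (fun N => HomologicalComplex.homologyOp (K.obj N.unop) p)
    (fun _ => HomologicalComplex.homologyOp_hom_naturality _ _)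

theorem groupCohomology_iso (p : ℕ) : Nonempty
    (((trivialOn (J := J) B).ι ⋙ groupCohomology.functor J G p).op ≅
      (((homFunctor J (toQuotient (J := J) B)).flip.mapHomologicalComplex _).obj
        (coinvariantsComplex B (Rep.barResolution J G).complex)).homology p) :=
  ⟨(homologyOpIso ((trivialOn (J := J) B).ι ⋙ groupCohomology.cochainsFunctor J G) p).symm ≪≫
    Functor.isoWhiskerRight (cochainsIso B) (HomologicalComplex.homologyFunctor _ _ p) ≪≫
    asFunctorHomologyIso _ p⟩

end CohomologyComparison

/-! ### From iterated sums to sums over the antidiagonal -/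

section DirectSums

variable {A : Type*} [Category* A] [Preadditive A]

/-- The object `W` is a direct sum of the finite family `f`. -/
def IsDirectSum {ι : Type*} [Fintype ι] (W : A) (f : ι → A) : Prop :=
  ∃ (i : ∀ j, f j ⟶ W) (p : ∀ j, W ⟶ f j), (∀ j, i j ≫ p j = 𝟙 (f j)) ∧
    (∀ j k, j ≠ k → i j ≫ p k = 0) ∧ ∑ j, p j ≫ i j = 𝟙 W

lemma IsDirectSum.of_iso {ι : Type*} [Fintype ι] {W W' : A} {f : ι → A} (h : IsDirectSum W f)
    (e : W' ≅ W) : IsDirectSum W' f := by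
  obtain ⟨i, p, h₁, h₂, h₃⟩ := h
  refine ⟨fun j => i j ≫ e.inv, fun j => e.hom ≫ p j, fun j => by simp [h₁],
    fun j k hjk => by simp [h₂ j k hjk], ?_⟩
  calc ∑ j, (e.hom ≫ p j) ≫ i j ≫ e.inv = e.hom ≫ (∑ j, p j ≫ i j) ≫ e.inv := by
        simp [Preadditive.comp_sum, Preadditive.sum_comp]
    _ = 𝟙 W' := by simp [h₃]

lemma IsDirectSum.reindex {ι κ : Type*} [Fintype ι] [Fintype κ] {W : A} {f : ι → A}
    (h : IsDirectSum W f) (e : κ ≃ ι) : IsDirectSum W fun k => f (e k) := by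
  obtain ⟨i, p, h₁, h₂, h₃⟩ := h
  refine ⟨fun j => i (e j), fun j => p (e j), fun j => h₁ _,
    fun j k hjk => h₂ _ _ (e.injective.ne hjk), ?_⟩
  rw [← h₃]
  exact e.sum_comp fun j => p j ≫ i j

lemma IsDirectSum.biprod_option [HasBinaryBiproducts A] {ι : Type*} [Fintype ι] {X W : A}
    {f : Option ι → A} (hX : f none = X) (h : IsDirectSum W fun j => f (some j)) :
    IsDirectSum (X ⊞ W) f := by
  subst hX
  obtain ⟨i, p, h₁, h₂, h₃⟩ := h
  refine ⟨fun j => match j with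
      | none => biprod.inl
      | some j => i j ≫ biprod.inr,
    fun j => match j with
      | none => biprod.fst
      | some j => biprod.snd ≫ p j, ?_, ?_, ?_⟩
  · rintro (_ | j)
    · simp
    · simp [h₁]
  · rintro (_ | j) (_ | k) hjk
    · exact absurd rfl hjk
    · simp
    · simp
    · simpa using h₂ j k fun h => hjk (congrArg some h)
  · rw [Fintype.sum_option]
    have : ∑ j, ((biprod.snd : f none ⊞ W ⟶ W) ≫ p j) ≫ i j ≫ (biprod.inr : W ⟶ f none ⊞ W) =
        (biprod.snd : f none ⊞ W ⟶ W) ≫ (∑ j, p j ≫ i j) ≫ (biprod.inr : W ⟶ f none ⊞ W) := by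
      simp [Preadditive.comp_sum, Preadditive.sum_comp]
    refine (congrArg (_ + ·) this).trans ?_
    rw [h₃, Category.id_comp, biprod.total]

/-- The pairs with sum `p + 1` are `(p + 1, 0)` and the pairs `(i, j + 1)` with `i + j = p`. -/
def antidiagonalSuccEquiv (p : ℕ) :
    Finset.HasAntidiagonal.antidiagonal (p + 1) ≃ Option (Finset.HasAntidiagonal.antidiagonal p) where
  toFun ij := if h : ij.1.2 = 0 then none else some ⟨(ij.1.1, ij.1.2 - 1), by
    have := Finset.HasAntidiagonal.mem_antidiagonal.1 ij.2
    rw [Finset.HasAntidiagonal.mem_antidiagonal]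
    omega⟩
  invFun
    | none => ⟨(p + 1, 0), by simp⟩
    | some ij => ⟨(ij.1.1, ij.1.2 + 1), by
        have := Finset.HasAntidiagonal.mem_antidiagonal.1 ij.2
        rw [Finset.HasAntidiagonal.mem_antidiagonal]
        omega⟩
  left_inv := by
    rintro ⟨⟨i, j⟩, h⟩
    rw [Finset.HasAntidiagonal.mem_antidiagonal] at h
    rcases j with _ | j
    · simpa using h.symm
    · simp
  right_inv := by
    rintro (_ | ⟨⟨i, j⟩, h⟩) <;> simp

lemma isDirectSum_diagonalSum {C : Type*} {A : Type*} [Category* A] [Abelian A]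
    (T : ℕ → C → A) (p : ℕ) : ∀ Q : ℕ → C, IsDirectSum (diagonalSum T p Q)
      fun ij : Finset.HasAntidiagonal.antidiagonal p => T ij.1.1 (Q ij.1.2) := by
  induction p with
  | zero =>
    intro Q
    have hu : ∀ j : Finset.HasAntidiagonal.antidiagonal 0, j = ⟨(0, 0), by simp⟩ := by
      rintro ⟨⟨i, j⟩, h⟩
      obtain ⟨rfl, rfl⟩ : i = 0 ∧ j = 0 := by simpa using h
      rfl
    refine ⟨fun j => eqToHom (by rw [hu j]; rfl), fun j => eqToHom (by rw [hu j]; rfl),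
      fun j => by simp, fun j k hjk => absurd ((hu j).trans (hu k).symm) hjk, ?_⟩
    rw [Fintype.sum_eq_single ⟨(0, 0), by simp⟩ fun j hj => absurd (hu j) hj]
    simp
  | succ p ih =>
    intro Q
    have h : IsDirectSum (diagonalSum T (p + 1) Q)
        fun o => (fun ij : Finset.HasAntidiagonal.antidiagonal (p + 1) => T ij.1.1 (Q ij.1.2))
          ((antidiagonalSuccEquiv p).symm o) :=
      IsDirectSum.biprod_option rfl (ih fun n => Q (n + 1))
    have h' := h.reindex (antidiagonalSuccEquiv p)
    simpa only [Equiv.symm_apply_apply] using h'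

end DirectSums

/-! ### Direct sums of functors -/

section Functors

variable {E : Type*} [Category* E] {D : Type*} [Category* D] [Preadditive D] [HasFiniteBiproducts D]
  {ι : Type} [Fintype ι]

/-- The direct sum of a finite family of functors, computed pointwise. -/
@[simps]
def pointwiseBiproduct (T : ι → E ⥤ D) : E ⥤ D where
  obj e := ⨁ fun j => (T j).obj e
  map f := biproduct.map fun j => (T j).map f

/-- A direct sum is a biproduct. -/
def isoBiproduct {W : D} {f : ι → D} (i : ∀ j, f j ⟶ W) (p : ∀ j, W ⟶ f j)
    (h₁ : ∀ j, i j ≫ p j = 𝟙 (f j)) (h₂ : ∀ j k, j ≠ k → i j ≫ p k = 0)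
    (h₃ : ∑ j, p j ≫ i j = 𝟙 W) : W ≅ ⨁ f where
  hom := biproduct.lift p
  inv := biproduct.desc i
  hom_inv_id := by rw [biproduct.lift_desc, h₃]
  inv_hom_id := by
    classical
    refine biproduct.hom_ext' _ _ fun j => biproduct.hom_ext _ _ fun k => ?_
    by_cases hjk : j = k
    · subst hjk
      simp [h₁]
    · simp [biproduct.ι_π_ne _ hjk, h₂ j k hjk]

omit [Fintype ι] in
lemma comp_lift_eq_lift_map {ι : Type} [Finite ι] {W W' : D} {f f' : ι → D} (p : ∀ j, W ⟶ f j) (p' : ∀ j, W' ⟶ f' j)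
    (a : W ⟶ W') (b : ∀ j, f j ⟶ f' j) (h : ∀ j, a ≫ p' j = p j ≫ b j) :
    a ≫ biproduct.lift p' = biproduct.lift p ≫ biproduct.map b :=
  biproduct.hom_ext _ _ fun j => by simp [h]

lemma nonempty_iso_pointwiseBiproduct {W : E ⥤ D} {T : ι → E ⥤ D} (h : IsDirectSum W T) :
    Nonempty (W ≅ pointwiseBiproduct T) := by
  obtain ⟨i, p, h₁, h₂, h₃⟩ := h
  refine ⟨NatIso.ofComponents (fun e => isoBiproduct (fun j => (i j).app e) (fun j => (p j).app e)
    (fun j => NatTrans.congr_app (h₁ j) e) (fun j k hjk => NatTrans.congr_app (h₂ j k hjk) e) ?_)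
    fun f => comp_lift_eq_lift_map _ _ _ _ fun j => (p j).naturality f⟩
  have := NatTrans.congr_app h₃ e
  rwa [NatTrans.app_sum] at this

omit [HasFiniteBiproducts D] in
-- Passing to opposites exchanges inclusions and projections.
lemma IsDirectSum.unop {W : Eᵒᵖ ⥤ Dᵒᵖ} {T : ι → Eᵒᵖ ⥤ Dᵒᵖ} (h : IsDirectSum W T) :
    IsDirectSum W.unop fun j => (T j).unop := by
  obtain ⟨i, p, h₁, h₂, h₃⟩ := h
  refine ⟨fun j => NatTrans.unop (p j), fun j => NatTrans.unop (i j), fun j => ?_, fun j k hjk => ?_,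
    ?_⟩
  · ext e
    exact congrArg Quiver.Hom.unop (NatTrans.congr_app (h₁ j) (.op e))
  · ext e
    exact congrArg Quiver.Hom.unop (NatTrans.congr_app (h₂ k j hjk.symm) (.op e))
  · ext e
    have := congrArg Quiver.Hom.unop (NatTrans.congr_app h₃ (.op e))
    rw [NatTrans.app_sum, unop_sum] at this
    rw [NatTrans.app_sum]
    exact this

end Functors

end NormalHomology

end

theorem mainTheorem6 {J G : Type u} [CommRing J] [Group G] (B : Subgroup G) [B.Normal]
    -- a resolution `P → J` of the trivial module by `JG`-modules
    (P : ChainComplex (Rep.{u} J G) ℕ)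
    (π : P ⟶ (ChainComplex.single₀ (Rep.{u} J G)).obj (Rep.trivial J G J)) (hπ : QuasiIso π)
    -- each `P_j` is projective as a `JB`-module
    (hproj : ∀ j, Projective ((Rep.resFunctor B.subtype).obj (P.X j)))
    -- the induced maps `P_{j+1} ⊗_{JB} J → P_j ⊗_{JB} J` are zero
    (hzero : ∀ j, (Rep.coinvariantsFunctor J B).map
      ((Rep.resFunctor B.subtype).map (P.d (j + 1) j)) = 0)
    (p : ℕ) :
    -- isomorphisms of functors on the category of `JG`-modules on which `B` acts trivially
    Nonempty ((NormalHomology.trivialOn (J := J) B).ι ⋙ groupHomology.functor J G p ≅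
      NormalHomology.toQuotient B ⋙ NormalHomology.torSum B p) ∧
    Nonempty ((NormalHomology.trivialOn (J := J) B).ι ⋙ groupCohomology.functor J G p ≅
      NormalHomology.toQuotient B ⋙ NormalHomology.extSum B p) := by
  open NormalHomology in
  constructor
  · obtain ⟨a⟩ := groupHomology_iso (J := J) B p
    obtain ⟨b⟩ := homology_coinvariantsComplex_iso B π hproj hzero
      (dimensionShift_tor (toQuotient (J := J) B)) (Rep.barResolution J G) p
    have h := (isDirectSum_diagonalSum (fun n X => toQuotient B ⋙ (Rep.Tor J (G ⧸ B) n).obj X) p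
      fun j => homologyRep B (Rep.trivial J G J) j).of_iso (a ≪≫ b)
    exact nonempty_iso_pointwiseBiproduct h
  · obtain ⟨a⟩ := groupCohomology_iso (J := J) B p
    obtain ⟨b⟩ := homology_coinvariantsComplex_iso B π hproj hzero
      (dimensionShift_ext J (toQuotient (J := J) B)) (Rep.barResolution J G) p
    have h := (isDirectSum_diagonalSum (pointwiseLeftDerived (homFunctor J (toQuotient (J := J) B))) p
      fun j => homologyRep B (Rep.trivial J G J) j).of_iso (a ≪≫ b)
    -- Ext is by definition the opposite of the left derived functors of `Hom(-, N)` into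
    -- `(ModuleCat J)ᵒᵖ`, so undoing the opposites gives the summands of `extSum` on the nose.
    exact nonempty_iso_pointwiseBiproduct h.unop
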